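/- **Setting.** For a dimension $d$, observations are triples $(X,Y,Z)\in\mathbb R\times\mathbb R\times\mathbb R^d$. For all sample sizes $n_1,n_2\in\mathbb N$ let $\mathcal P=\mathcal P_{n_1,n_2}$ be a family of laws $P$ of $(X,Y,Z)$; the family and $d$ may depend on $(n_1,n_2)$. Under each $P\in\mathcal P$ the variables $X,Y,Z$ are square integrable and satisfy the linear model $Y=\beta_PX+\gamma_P^\top Z+\zeta_P$ with $\mathbb E_P(\zeta_P\mid X,Z)=0$. Let $\eta_P,\theta_P\in\mathbb R^d$ be coefficient vectors of the population least squares projections of $X$ on $Z$ and of $Y$ on $Z$, i.e. minimisers over $b$ of $\mathbb E_P\{(X-b^\top Z)^2\}$ and $\mathbb E_P\{(Y-b^\top Z)^2\}$, and put $\xi_P:=X-\eta_P^\top Z$, $\varepsilon_P:=Y-\theta_P^\top Z$, $\sigma_{P,\xi}^2:=\mathbb E_P(\xi_P^2)$ (so $\sigma_{P,\xi}^2=\mathrm{Var}_P(\xi_P)$ whenever $\mathbb E_P(\xi_P)=0$) and $\sigma_{P,\varepsilon\xi}^2:=\mathrm{Var}_P(\varepsilon_P\xi_P)$. The independent data sets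 $\mathcal D_1$, $\mathcal D_2$ consist of $n_1$ and $n_2$ i.i.d. observations from $P$; $\mathcal I_1$ indexes $\mathcal D_1$. The (possibly randomised) estimator $\hat\beta$ of $\beta_P$ is trained on $\mathcal D_2$, and the estimators $\hat\eta,\hat\theta$ of $\eta_P,\theta_P$ are trained on $\mathcal D_1$, any random seeds used for $\mathcal D_1$ and for $\mathcal D_2$ being independent of each other and of the data. All limits are as $\min\{n_1,n_2\}\to\infty$ unless indicated otherwise, and $W=o_{\mathcal P}(1)$ means $\sup_{P\in\mathcal P}\mathbb P_P(|W|>\epsilon)\to0$ for every $\epsilon>0$. $\Phi$ is the standard normal distribution function and $z_a$ its $a$-th quantile. **Assumptions on the estimators.** For every $P\in\mathcal P$ the limit $\sigma_{\beta_P}^2:=\lim_{m\to\infty}\mathrm{Var}_P(\sqrt{m}(\hat\beta-\beta_P))$, with $\hat\beta$ trained on $m$ observations from $P$, exists in $(0,\infty)$ (put $\sigma_{\beta_P}>0$), and $$\sup_{P\in\mathcal P}\sup_{t\in\mathbb R}\bigl|\mathbb P_P\bigl(\sqrt{n_2}\,\sigma_{\beta_P}^{-1}(\hat\beta-\beta_P)\le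 t\bigr)-\Phi(t)\bigr|\to0,$$ and each of the following is $o_{\mathcal P}(1)$: 1. $\sqrt{n_1}\,\|\hat\theta-\theta_P\|_2\,\bigl\|\frac1{n_1}\sum_{i\in\mathcal I_1}(X_i-\eta_P^\top Z_i)Z_i\bigr\|_2$; 2. $\sqrt{n_1}\,\|\hat\eta-\eta_P\|_2\,\bigl\|\frac1{n_1}\sum_{i\in\mathcal I_1}(Y_i-\theta_P^\top Z_i)Z_i\bigr\|_2$; 3. $\sqrt{n_1}\,\|\hat\eta-\eta_P\|_2\,\|\hat\theta-\theta_P\|_2\,\bigl\|\frac1{n_1}\sum_{i\in\mathcal I_1}Z_iZ_i^\top\bigr\|_{\mathrm{op}}$; 4. $\|\hat\theta-\theta_P\|_2^2\cdot\frac1{n_1}\sum_{i\in\mathcal I_1}(X_i-\eta_P^\top Z_i)^2\|Z_i\|_2^2$; 5. $\|\hat\eta-\eta_P\|_2^2\cdot\frac1{n_1}\sum_{i\in\mathcal I_1}(Y_i-\theta_P^\top Z_i)^2\|Z_i\|_2^2$; 6. $\|\hat\eta-\eta_P\|_2^2\,\|\hat\theta-\theta_P\|_2^2\cdot\frac1{n_1}\sum_{i\in\mathcal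 I_1}\|Z_i\|_2^4$. **Moment conditions.** There are $c,C,\delta>0$ with $\sigma_{P,\varepsilon\xi}^2>c$ and $\mathbb E_P\{|\varepsilon_P\xi_P|^{2+\delta}\}\le C$ for all $P\in\mathcal P_{n_1,n_2}$ and all $n_1,n_2$. **Test.** The projected covariance measure (PCM) statistic with $\hat v\equiv1$ is, with $L_i:=\hat\beta\,(Y_i-\hat\theta^\top Z_i)(X_i-\hat\eta^\top Z_i)$ and the convention $0/0:=0$, $$T:=\frac{\frac1{\sqrt{n_1}}\sum_{i\in\mathcal I_1}L_i}{\sqrt{\frac1{n_1}\sum_{i\in\mathcal I_1}L_i^2-\bigl(\frac1{n_1}\sum_{i\in\mathcal I_1}L_i\bigr)^2}} .$$ The value of $T$ when the denominator vanishes and the numerator does not is immaterial; it is set to $0$. **Proposition.** Let $\alpha\in(0,1)$ and $$\psi_{P,\alpha,n}:=\Phi\Bigl(\frac{\sqrt{n_2}\beta_P}{\sigma_{\beta_P}}\Bigr)\Phi\Bigl(z_\alpha+\frac{\sqrt{n_1}\beta_P\sigma_{P,\xi}^2}{\sigma_{P,\varepsilon\xi}}\Bigr)+\Phi\Bigl(-\frac{\sqrt{n_2}\beta_P}{\sigma_{\beta_P}}\Bigr)\Phi\Bigl(z_\alpha-\frac{\sqrt{n_1}\beta_P\sigma_{P,\xi}^2}{\sigma_{P,\varepsilon\xi}}\Bigr).$$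 Then $$\sup_{P\in\mathcal P}\bigl|\mathbb P_P(T>z_{1-\alpha})-\psi_{P,\alpha,n}\bigr|\to0\quad\text{as }\min\{n_1,n_2\}\to\infty .$$ Furthermore, if $\alpha<1/2$, then $\psi_{P,\alpha,n}\ge\alpha$ for all $n_1,n_2\ge1$ and $P\in\mathcal P$, with equality if and only if $\beta_P=0$. -/

import Mathlib

open MeasureTheory ProbabilityTheory Filter Topology
open scoped ENNReal

noncomputable section

namespace PCM

/-- A single observation `(x, y, z)` with `x, y` real and `z` a Euclidean vector. -/
abbrev Obs (d : ℕ) : Type := ℝ × ℝ × EuclideanSpace ℝ (Fin d)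

/-- The residual `x - bᵀz` of the first coordinate. -/
def resX {d : ℕ} (b : EuclideanSpace ℝ (Fin d)) (o : Obs d) : ℝ := o.1 - inner ℝ b o.2.2

/-- The residual `y - bᵀz` of the second coordinate. -/
def resY {d : ℕ} (b : EuclideanSpace ℝ (Fin d)) (o : Obs d) : ℝ := o.2.1 - inner ℝ b o.2.2

/-- The standard normal distribution function `Φ`. -/
def stdNormalCDF (t : ℝ) : ℝ := cdf (gaussianReal 0 1) t

/-- The `a`-th quantile `z_a` of the standard normal distribution, for `0 < a < 1`. -/
def stdNormalQuantile (a : ℝ) : ℝ := sInf {x : ℝ | a ≤ stdNormalCDF x}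

/-- The population quantities attached to a distribution: the regression coefficients `β`, `γ`, the
coefficients `η`, `θ` of the projections of `X` and of `Y` on `Z`, and the asymptotic standard
deviation of the estimator of `β`. -/
structure Params (d : ℕ) where
  beta : ℝ
  gamma : EuclideanSpace ℝ (Fin d)
  eta : EuclideanSpace ℝ (Fin d)
  theta : EuclideanSpace ℝ (Fin d)
  sigmaBeta : ℝ

/-- `Y = β X + γᵀZ + ζ` with `E(ζ | X, Z) = 0`. -/
def IsLinearModel {d : ℕ} (P : Measure (Obs d)) (β : ℝ) (γ : EuclideanSpace ℝ (Fin d)) : Prop :=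
  P[fun o : Obs d => o.2.1 - β * o.1 - inner ℝ γ o.2.2 |
    MeasurableSpace.comap (fun o : Obs d => (o.1, o.2.2)) inferInstance] =ᵐ[P] 0

/-- `b` is a coefficient vector of the population least squares projection of `W` on `Z`. -/
def IsLeastSquaresProjection {d : ℕ} (P : Measure (Obs d)) (W : Obs d → ℝ)
    (b : EuclideanSpace ℝ (Fin d)) : Prop :=
  ∀ b' : EuclideanSpace ℝ (Fin d),
    ∫ o, (W o - inner ℝ b o.2.2) ^ 2 ∂P ≤ ∫ o, (W o - inner ℝ b' o.2.2) ^ 2 ∂P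

/-- `X`, `Y` and `Z` are square integrable. -/
def HasSecondMoments {d : ℕ} (P : Measure (Obs d)) : Prop :=
  MemLp (fun o : Obs d => o.1) 2 P ∧ MemLp (fun o : Obs d => o.2.1) 2 P ∧
    MemLp (fun o : Obs d => o.2.2) 2 P

/-- A data set of `m` observations together with the random seed, in `U`, of a possibly randomised
estimator. -/
abbrev TrainSpace (U : Type*) (d m : ℕ) : Type _ := (Fin m → Obs d) × U

/-- The law of `m` independent observations from `P` and an independent seed with law `ν`. -/
def trainLaw {U : Type*} [MeasurableSpace U] (ν : Measure U) {d : ℕ}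
    (P : ProbabilityMeasure (Obs d)) (m : ℕ) : Measure (TrainSpace U d m) :=
  (Measure.pi fun _ : Fin m => (P : Measure (Obs d))).prod ν

/-- The two data sets `D₁` (of size `n₁`) and `D₂` (of size `n₂`), each with its seed. -/
abbrev SampleSpace (U₁ U₂ : Type*) (d n₁ n₂ : ℕ) : Type _ := TrainSpace U₁ d n₁ × TrainSpace U₂ d n₂

/-- The joint law of the two independent data sets. -/
def sampleLaw {U₁ U₂ : Type*} [MeasurableSpace U₁] [MeasurableSpace U₂]
    (ν₁ : Measure U₁) (ν₂ : Measure U₂) {d : ℕ} (P : ProbabilityMeasure (Obs d)) (n₁ n₂ : ℕ) :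
    Measure (SampleSpace U₁ U₂ d n₁ n₂) :=
  (trainLaw ν₁ P n₁).prod (trainLaw ν₂ P n₂)

/-- Estimators for every dimension and sample size: `η̂` and `θ̂` are to be trained on `D₁`, and
`β̂` on `D₂`. -/
structure Estimators (U₁ U₂ : Type*) [MeasurableSpace U₁] [MeasurableSpace U₂] where
  beta : ∀ d m : ℕ, TrainSpace U₂ d m → ℝ
  eta : ∀ d m : ℕ, TrainSpace U₁ d m → EuclideanSpace ℝ (Fin d)
  theta : ∀ d m : ℕ, TrainSpace U₁ d m → EuclideanSpace ℝ (Fin d)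
  measurable_beta : ∀ d m, Measurable (beta d m)
  measurable_eta : ∀ d m, Measurable (eta d m)
  measurable_theta : ∀ d m, Measurable (theta d m)

/-- The studentised statistic of `L₁, …, Lₙ`, with the convention `0 / 0 = 0`. -/
def studentised {n : ℕ} (L : Fin n → ℝ) : ℝ :=
  ((1 / √(n : ℝ)) * ∑ i, L i) /
    √((1 / (n : ℝ)) * ∑ i, L i ^ 2 - ((1 / (n : ℝ)) * ∑ i, L i) ^ 2)

section Sample

variable {U₁ U₂ : Type*} [MeasurableSpace U₁] [MeasurableSpace U₂]

/-- The PCM statistic with `v̂ ≡ 1`, that is the studentised statistic of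
`Lᵢ = β̂ (Yᵢ - θ̂ᵀZᵢ) (Xᵢ - η̂ᵀZᵢ)`, where `i` runs through `D₁`. -/
def pcmStatistic (est : Estimators U₁ U₂) (d n₁ n₂ : ℕ) (ω : SampleSpace U₁ U₂ d n₁ n₂) : ℝ :=
  studentised fun i : Fin n₁ =>
    est.beta d n₂ ω.2 * (resY (est.theta d n₁ ω.1) (ω.1.1 i) * resX (est.eta d n₁ ω.1) (ω.1.1 i))

/-- The filter expressing `min {n₁, n₂} → ∞`. -/
def minAtTop : Filter (ℕ × ℕ) := comap (fun n : ℕ × ℕ => min n.1 n.2) atTop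

/-- `W = o(1)` in probability, uniformly over the family `Fam` of distributions: the supremum over
`P` in `Fam` of the probability of `|W| > ε` tends to `0` for every `ε > 0`. The family and the
dimension `d` may depend on the sample sizes. -/
def IsLittleOP (ν₁ : Measure U₁) (ν₂ : Measure U₂) (d : ℕ → ℕ → ℕ)
    (Fam : ∀ n₁ n₂ : ℕ, Set (ProbabilityMeasure (Obs (d n₁ n₂))))
    (W : ∀ n₁ n₂ : ℕ, ProbabilityMeasure (Obs (d n₁ n₂)) →
      SampleSpace U₁ U₂ (d n₁ n₂) n₁ n₂ → ℝ) : Prop :=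
  ∀ ε : ℝ, 0 < ε →
    Tendsto (fun n : ℕ × ℕ => ⨆ P ∈ Fam n.1 n.2,
      sampleLaw ν₁ ν₂ P n.1 n.2 {ω | ε < |W n.1 n.2 P ω|}) minAtTop (𝓝 0)

/-- The operator norm of `n⁻¹ ∑ᵢ Zᵢ Zᵢᵀ`. -/
def gramOpNorm {d n : ℕ} (D : Fin n → Obs d) : ℝ :=
  ‖Matrix.toEuclideanCLM (n := Fin d) (𝕜 := ℝ)
    ((1 / (n : ℝ)) • ∑ i, Matrix.vecMulVec (D i).2.2.ofLp (D i).2.2.ofLp)‖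

/-- The assumption on the family `Fam`, its parameters `par` and the estimators `est`: the linear
model, the population projections, the asymptotic variance and uniform asymptotic normality of
`β̂`, and the conditions on `η̂` and `θ̂`. -/
structure UnivariateXAssumption (ν₁ : Measure U₁) (ν₂ : Measure U₂) (est : Estimators U₁ U₂)
    (d : ℕ → ℕ → ℕ) (Fam : ∀ n₁ n₂ : ℕ, Set (ProbabilityMeasure (Obs (d n₁ n₂))))
    (par : ∀ k : ℕ, ProbabilityMeasure (Obs k) → Params k) : Prop where
  second_moments : ∀ n₁ n₂, ∀ P ∈ Fam n₁ n₂, HasSecondMoments (P : Measure (Obs (d n₁ n₂)))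
  linear_model : ∀ n₁ n₂, ∀ P ∈ Fam n₁ n₂,
    IsLinearModel (P : Measure (Obs (d n₁ n₂))) (par _ P).beta (par _ P).gamma
  eta_projection : ∀ n₁ n₂, ∀ P ∈ Fam n₁ n₂,
    IsLeastSquaresProjection (P : Measure (Obs (d n₁ n₂))) (fun o => o.1) (par _ P).eta
  theta_projection : ∀ n₁ n₂, ∀ P ∈ Fam n₁ n₂,
    IsLeastSquaresProjection (P : Measure (Obs (d n₁ n₂))) (fun o => o.2.1) (par _ P).theta
  sigmaBeta_pos : ∀ n₁ n₂, ∀ P ∈ Fam n₁ n₂, 0 < (par _ P).sigmaBeta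
  sigmaBeta_limit : ∀ n₁ n₂, ∀ P ∈ Fam n₁ n₂,
    Tendsto (fun m : ℕ => variance
      (fun w => √(m : ℝ) * (est.beta (d n₁ n₂) m w - (par _ P).beta)) (trainLaw ν₂ P m))
      atTop (𝓝 ((par _ P).sigmaBeta ^ 2))
  beta_normal :
    Tendsto (fun n : ℕ × ℕ => ⨆ P ∈ Fam n.1 n.2, ⨆ t : ℝ, ENNReal.ofReal
      |(sampleLaw ν₁ ν₂ P n.1 n.2).real
          {ω | √(n.2 : ℝ) * (par _ P).sigmaBeta⁻¹ *
            (est.beta (d n.1 n.2) n.2 ω.2 - (par _ P).beta) ≤ t} - stdNormalCDF t|)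
      minAtTop (𝓝 0)
  theta_cross : IsLittleOP ν₁ ν₂ d Fam fun n₁ _ P ω =>
    √(n₁ : ℝ) * ‖est.theta _ n₁ ω.1 - (par _ P).theta‖ *
      ‖(1 / (n₁ : ℝ)) • ∑ i, resX (par _ P).eta (ω.1.1 i) • (ω.1.1 i).2.2‖
  eta_cross : IsLittleOP ν₁ ν₂ d Fam fun n₁ _ P ω =>
    √(n₁ : ℝ) * ‖est.eta _ n₁ ω.1 - (par _ P).eta‖ *
      ‖(1 / (n₁ : ℝ)) • ∑ i, resY (par _ P).theta (ω.1.1 i) • (ω.1.1 i).2.2‖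
  eta_theta_gram : IsLittleOP ν₁ ν₂ d Fam fun n₁ _ P ω =>
    √(n₁ : ℝ) * ‖est.eta _ n₁ ω.1 - (par _ P).eta‖ * ‖est.theta _ n₁ ω.1 - (par _ P).theta‖ *
      gramOpNorm ω.1.1
  theta_square : IsLittleOP ν₁ ν₂ d Fam fun n₁ _ P ω =>
    ‖est.theta _ n₁ ω.1 - (par _ P).theta‖ ^ 2 *
      ((1 / (n₁ : ℝ)) * ∑ i, resX (par _ P).eta (ω.1.1 i) ^ 2 * ‖(ω.1.1 i).2.2‖ ^ 2)
  eta_square : IsLittleOP ν₁ ν₂ d Fam fun n₁ _ P ω =>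
    ‖est.eta _ n₁ ω.1 - (par _ P).eta‖ ^ 2 *
      ((1 / (n₁ : ℝ)) * ∑ i, resY (par _ P).theta (ω.1.1 i) ^ 2 * ‖(ω.1.1 i).2.2‖ ^ 2)
  eta_theta_square : IsLittleOP ν₁ ν₂ d Fam fun n₁ _ P ω =>
    ‖est.eta _ n₁ ω.1 - (par _ P).eta‖ ^ 2 * ‖est.theta _ n₁ ω.1 - (par _ P).theta‖ ^ 2 *
      ((1 / (n₁ : ℝ)) * ∑ i, ‖(ω.1.1 i).2.2‖ ^ 4)

end Sample

/-- The product `ε ξ` of the population residuals of `Y` and of `X` on `Z`. -/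
def epsXi {d : ℕ} (p : Params d) (o : Obs d) : ℝ := resY p.theta o * resX p.eta o

/-- `σ_ξ² = E(ξ²)`, which is the variance of `ξ` when `ξ` is centred. -/
def sigmaXiSq {d : ℕ} (P : ProbabilityMeasure (Obs d)) (p : Params d) : ℝ :=
  ∫ o, resX p.eta o ^ 2 ∂(P : Measure (Obs d))

/-- `σ_{εξ}`, the standard deviation of `ε ξ`. -/
def sigmaEpsXi {d : ℕ} (P : ProbabilityMeasure (Obs d)) (p : Params d) : ℝ :=
  √(variance (epsXi p) (P : Measure (Obs d)))

/-- The asymptotic power `ψ`. -/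
def psi {d : ℕ} (P : ProbabilityMeasure (Obs d)) (p : Params d) (α : ℝ) (n₁ n₂ : ℕ) : ℝ :=
  stdNormalCDF (√(n₂ : ℝ) * p.beta / p.sigmaBeta) *
      stdNormalCDF (stdNormalQuantile α + √(n₁ : ℝ) * p.beta * sigmaXiSq P p / sigmaEpsXi P p) +
    stdNormalCDF (-(√(n₂ : ℝ) * p.beta / p.sigmaBeta)) *
      stdNormalCDF (stdNormalQuantile α - √(n₁ : ℝ) * p.beta * sigmaXiSq P p / sigmaEpsXi P p)

end PCM

end

/-! The factor `β̂` is common to all summands and studentisation divides out its modulus, so `T =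
sign(β̂) · S`, where `S` (`residualStatistic`) uses only the first data set (`pcmStatistic_eq`). The
sign depends only on the second, independent data set. Hence `P(T > z)` is `P(β̂ > 0) P(S > z) +
P(β̂ < 0) P(-S > z)` up to the mass of `β̂` at zero (`abs_measureReal_prod_sign_sub_le`). Asymptotic
normality of `β̂` gives the two weights and makes that mass small (`sign_probabilities`).

For the tails of `S`, the product of estimated residuals is `εξ` plus a perturbation. The first
three rate conditions make the normalised sum of the perturbation negligible, the last three its
mean square. The numerator of `S` is then close to a standardised sum scaled by `σ`, plus the drift
`√n₁ E(εξ)`, and the denominator is close to `σ` (`residualStatistic_sandwich`). The drift is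
identified by `integral_epsXi_eq`: orthogonality of `ξ` to `Z` and to the regression error leaves
`E(εξ) = β σ_ξ²`.

Uniformity over laws and dimensions comes from a central limit theorem and laws of large numbers
whose error depends only on `q`, `c`, `C` (`eventually_forall_sample_limits`). The drift may be
unbounded. This is harmless because the central limit theorem is uniform in the threshold and `Φ` is
1-Lipschitz, so a threshold error `τ` costs a multiple of `τ` in probability wherever the threshold
lies.

The bound `ψ ≥ α` is a property of `Φ`: for `z ≤ 0` the equal-weight average of `Φ(z + k)` and `Φ(z
- k)` is at least `Φ(z)`, and the correct sign of `β̂` has weight above one half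
(`lt_stdNormalCDF_mixture`). -/

namespace PCM

/-! ### The standard normal distribution function and its quantiles. -/

lemma stdNormalCDF_eq_real (t : ℝ) :
    stdNormalCDF t = (gaussianReal 0 1).real (Set.Iic t) := cdf_eq_real _ t

lemma stdNormalCDF_nonneg (t : ℝ) : 0 ≤ stdNormalCDF t := cdf_nonneg _ t

lemma stdNormalCDF_le_one (t : ℝ) : stdNormalCDF t ≤ 1 := cdf_le_one _ t

lemma stdNormalCDF_eq_integral (t : ℝ) :
    stdNormalCDF t = ∫ x in Set.Iic t, gaussianPDFReal 0 1 x := by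
  rw [stdNormalCDF_eq_real, measureReal_def, gaussianReal_apply_eq_integral _ one_ne_zero,
    ENNReal.toReal_ofReal]
  exact integral_nonneg fun x => gaussianPDFReal_nonneg _ _ _

lemma stdNormalCDF_sub (s t : ℝ) :
    stdNormalCDF t - stdNormalCDF s = ∫ x in s..t, gaussianPDFReal 0 1 x := by
  rw [stdNormalCDF_eq_integral, stdNormalCDF_eq_integral]
  exact intervalIntegral.integral_Iic_sub_Iic (integrable_gaussianPDFReal 0 1).integrableOn
    (integrable_gaussianPDFReal 0 1).integrableOn

lemma continuous_stdNormalPDF : Continuous (gaussianPDFReal 0 1) := by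
  unfold gaussianPDFReal
  fun_prop

lemma stdNormalPDF_le_one (x : ℝ) : gaussianPDFReal 0 1 x ≤ 1 := by
  unfold gaussianPDFReal
  have h1 : (1 : ℝ) ≤ √(2 * Real.pi * (1 : NNReal)) := by
    rw [Real.one_le_sqrt]
    have := Real.pi_gt_three
    push_cast
    linarith
  have h2 : Real.exp (-(x - 0) ^ 2 / (2 * (1 : NNReal))) ≤ 1 := by
    rw [Real.exp_le_one_iff]
    have := sq_nonneg (x - 0)
    push_cast
    linarith
  exact mul_le_one₀ (inv_le_one_of_one_le₀ h1) (Real.exp_pos _).le h2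

/-- The standard normal density decreases in the absolute value of its argument. -/
lemma stdNormalPDF_le_of_sq_le {x y : ℝ} (h : x ^ 2 ≤ y ^ 2) :
    gaussianPDFReal 0 1 y ≤ gaussianPDFReal 0 1 x := by
  unfold gaussianPDFReal
  gcongr ?_ * Real.exp ?_
  push_cast
  linarith

lemma strictMono_stdNormalCDF : StrictMono stdNormalCDF := by
  intro s t hst
  rw [← sub_pos, stdNormalCDF_sub]
  exact intervalIntegral.intervalIntegral_pos_of_pos
    (continuous_stdNormalPDF.intervalIntegrable _ _)
    (fun x => gaussianPDFReal_pos _ _ _ one_ne_zero) hst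

/-- The density is at most one. This is what turns errors in a threshold into errors in a
probability, uniformly in the threshold. -/
lemma stdNormalCDF_le_add {s t : ℝ} (hst : s ≤ t) :
    stdNormalCDF t ≤ stdNormalCDF s + (t - s) := by
  have h : ∫ x in s..t, gaussianPDFReal 0 1 x ≤ ∫ _ in s..t, (1 : ℝ) :=
    intervalIntegral.integral_mono_on hst (continuous_stdNormalPDF.intervalIntegrable _ _)
      (by simp) fun x _ => stdNormalPDF_le_one x
  rw [← stdNormalCDF_sub] at h
  simp only [intervalIntegral.integral_const, smul_eq_mul, mul_one] at h
  linarith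

lemma abs_stdNormalCDF_sub_le (s t : ℝ) : |stdNormalCDF t - stdNormalCDF s| ≤ |t - s| := by
  rcases le_total s t with h | h
  · rw [abs_of_nonneg (sub_nonneg.2 (strictMono_stdNormalCDF.monotone h)),
      abs_of_nonneg (sub_nonneg.2 h)]
    linarith [stdNormalCDF_le_add h]
  · rw [abs_of_nonpos (sub_nonpos.2 (strictMono_stdNormalCDF.monotone h)),
      abs_of_nonpos (sub_nonpos.2 h)]
    linarith [stdNormalCDF_le_add h]

lemma continuous_stdNormalCDF : Continuous stdNormalCDF :=
  (LipschitzWith.of_dist_le_mul (K := 1) fun x y => by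
    simpa [Real.dist_eq] using abs_stdNormalCDF_sub_le y x).continuous

lemma tendsto_stdNormalCDF_atBot : Tendsto stdNormalCDF atBot (𝓝 0) := tendsto_cdf_atBot _

lemma tendsto_stdNormalCDF_atTop : Tendsto stdNormalCDF atTop (𝓝 1) := tendsto_cdf_atTop _

lemma stdNormalCDF_neg (t : ℝ) : stdNormalCDF (-t) = 1 - stdNormalCDF t := by
  have h1 : (gaussianReal 0 1).real (Set.Iic (-t)) = (gaussianReal 0 1).real (Set.Ici t) := by
    have h := gaussianReal_map_neg (μ := 0) (v := 1)
    rw [neg_zero] at h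
    conv_lhs => rw [← h]
    rw [map_measureReal_apply measurable_neg measurableSet_Iic]
    congr 1
    ext x
    simp
  have h2 : (gaussianReal 0 1).real (Set.Ici t) = (gaussianReal 0 1).real (Set.Ioi t) := by
    have := nullSingletonClass_gaussianReal (μ := 0) (one_ne_zero (α := NNReal))
    exact measureReal_congr Ioi_ae_eq_Ici.symm
  rw [stdNormalCDF_eq_real, stdNormalCDF_eq_real, h1, h2, ← Set.compl_Iic,
    probReal_compl_eq_one_sub measurableSet_Iic]

lemma stdNormalCDF_quantile {a : ℝ} (h0 : 0 < a) (h1 : a < 1) :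
    stdNormalCDF (stdNormalQuantile a) = a := by
  obtain ⟨x, hx⟩ : ∃ x, stdNormalCDF x = a :=
    mem_range_of_exists_le_of_exists_ge continuous_stdNormalCDF
      ((tendsto_stdNormalCDF_atBot.eventually (eventually_le_nhds h0)).exists)
      ((tendsto_stdNormalCDF_atTop.eventually (eventually_ge_nhds h1)).exists)
  have : {y : ℝ | a ≤ stdNormalCDF y} = Set.Ici x := by
    ext y
    rw [Set.mem_ofPred_eq, ← hx, strictMono_stdNormalCDF.le_iff_le, Set.mem_Ici]
  rw [stdNormalQuantile, this, csInf_Ici, hx]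

lemma stdNormalQuantile_one_sub {a : ℝ} (h0 : 0 < a) (h1 : a < 1) :
    stdNormalQuantile (1 - a) = -stdNormalQuantile a := by
  apply strictMono_stdNormalCDF.injective
  rw [stdNormalCDF_neg, stdNormalCDF_quantile h0 h1,
    stdNormalCDF_quantile (sub_pos.2 h1) (by linarith)]

lemma stdNormalCDF_zero : stdNormalCDF 0 = 1 / 2 := by
  have := stdNormalCDF_neg 0
  rw [neg_zero] at this
  linarith

/-- Convexity of the normal distribution function on the negative half-line, extended to symmetric
intervals. -/
lemma two_mul_stdNormalCDF_le {z k : ℝ} (hz : z ≤ 0) (hk : 0 ≤ k) :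
    2 * stdNormalCDF z ≤ stdNormalCDF (z + k) + stdNormalCDF (z - k) := by
  have h1 : ∫ x in (0 : ℝ)..k, gaussianPDFReal 0 1 (z - x) ≤
      ∫ x in (0 : ℝ)..k, gaussianPDFReal 0 1 (z + x) := by
    refine intervalIntegral.integral_mono_on hk
      ((continuous_stdNormalPDF.comp (by fun_prop)).intervalIntegrable _ _)
      ((continuous_stdNormalPDF.comp (by fun_prop)).intervalIntegrable _ _) fun x hx => ?_
    -- Since `z ≤ 0 ≤ x`, the point `z + x` is at least as close to the mode as `z - x`.
    apply stdNormalPDF_le_of_sq_le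
    nlinarith [mul_nonneg (neg_nonneg.2 hz) hx.1]
  rw [intervalIntegral.integral_comp_sub_left (fun x => gaussianPDFReal 0 1 x),
    intervalIntegral.integral_comp_add_left (fun x => gaussianPDFReal 0 1 x),
    ← stdNormalCDF_sub, ← stdNormalCDF_sub] at h1
  simp only [sub_zero, add_zero] at h1
  linarith

/-- With weights one half the right side is already at least `Φ(z)`; since `Φ(b) > 1/2`, weight
moves to the strictly larger of the two values. -/
lemma lt_stdNormalCDF_mixture {z b k : ℝ} (hz : z ≤ 0) (hb : 0 < b) (hk : 0 < k) :
    stdNormalCDF z < stdNormalCDF b * stdNormalCDF (z + k) +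
      stdNormalCDF (-b) * stdNormalCDF (z - k) := by
  have h1 := two_mul_stdNormalCDF_le hz hk.le
  have h2 : stdNormalCDF (z - k) < stdNormalCDF (z + k) := strictMono_stdNormalCDF (by linarith)
  have h3 : 1 / 2 < stdNormalCDF b := by
    rw [← stdNormalCDF_zero]
    exact strictMono_stdNormalCDF hb
  rw [stdNormalCDF_neg]
  nlinarith [mul_pos (sub_pos.2 h3) (sub_pos.2 h2)]

/-- Pólya's theorem: pointwise convergence of monotone functions to the normal distribution function
is uniform. -/
lemma eventually_abs_sub_stdNormalCDF_le {ι : Type*} {l : Filter ι} {F : ι → ℝ → ℝ}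
    (hmono : ∀ i, Monotone (F i)) (h0 : ∀ i t, 0 ≤ F i t) (h1 : ∀ i t, F i t ≤ 1)
    (h : ∀ t, Tendsto (fun i => F i t) l (𝓝 (stdNormalCDF t))) {ε : ℝ} (hε : 0 < ε) :
    ∀ᶠ i in l, ∀ t, |F i t - stdNormalCDF t| ≤ ε := by
  obtain ⟨a, ha⟩ := (tendsto_stdNormalCDF_atBot.eventually
    (eventually_le_nhds (half_pos hε))).exists
  obtain ⟨b, hb⟩ := (tendsto_stdNormalCDF_atTop.eventually
    (eventually_ge_nhds (show 1 - ε / 2 < 1 by linarith))).exists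
  -- A grid of mesh `ε / 2` from `a` past `b`: by the Lipschitz bound `Φ` grows by at most `ε / 2`
  -- per cell. A point of `[a, b)` has left index below `K`, so both endpoints of its cell are in
  -- `range (K + 2)`.
  obtain ⟨K, hK⟩ := exists_nat_gt ((b - a) / (ε / 2))
  have hgrid : ∀ᶠ i in l, ∀ j ∈ Finset.range (K + 2),
      |F i (a + j * (ε / 2)) - stdNormalCDF (a + j * (ε / 2))| ≤ ε / 2 := by
    rw [eventually_all_finset]
    intro j _
    have := (h (a + j * (ε / 2))).eventually (Metric.closedBall_mem_nhds _ (half_pos hε))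
    simpa [Real.dist_eq] using this
  have hb' := (h b).eventually (Metric.closedBall_mem_nhds _ (half_pos hε))
  filter_upwards [hgrid, hb'] with i hi hbi t
  rw [Real.dist_eq] at hbi
  have hai := hi 0 (by simp)
  simp only [Nat.cast_zero, zero_mul, add_zero] at hai
  rw [abs_le] at hai hbi ⊢
  rcases lt_or_ge t a with hta | hta
  · have e1 := hmono i hta.le
    have e2 := strictMono_stdNormalCDF.monotone hta.le
    have e3 := h0 i t
    have e4 := stdNormalCDF_nonneg t
    constructor <;> linarith
  rcases le_or_gt b t with htb | htb
  · have e1 := hmono i htb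
    have e2 := strictMono_stdNormalCDF.monotone htb
    have e3 := h1 i t
    have e4 := stdNormalCDF_le_one t
    constructor <;> linarith
  have hε2 := half_pos hε
  set j := ⌊(t - a) / (ε / 2)⌋₊ with hj
  have hj1 : (j : ℝ) * (ε / 2) ≤ t - a := by
    rw [← le_div_iff₀ hε2]
    exact Nat.floor_le (div_nonneg (by linarith) hε2.le)
  have hj2 : t - a < ((j + 1 : ℕ) : ℝ) * (ε / 2) := by
    rw [← div_lt_iff₀ hε2]
    exact_mod_cast Nat.lt_floor_add_one _
  have hjK : j < K := by
    have : (j : ℝ) < K := by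
      refine lt_of_le_of_lt ?_ hK
      rw [le_div_iff₀ hε2]
      linarith
    exact_mod_cast this
  have a1 := hi j (by simp; omega)
  have a2 := hi (j + 1) (by simp; omega)
  have b1 := hmono i (show a + j * (ε / 2) ≤ t by linarith)
  have b2 := hmono i (show t ≤ a + ((j + 1 : ℕ) : ℝ) * (ε / 2) by linarith)
  have c1 := stdNormalCDF_le_add (show a + j * (ε / 2) ≤ t by linarith)
  have c2 := stdNormalCDF_le_add (show t ≤ a + ((j + 1 : ℕ) : ℝ) * (ε / 2) by linarith)
  rw [abs_le] at a1 a2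
  push_cast at *
  constructor <;> linarith

/-! ### A central limit theorem uniform over laws, by characteristic functions. -/

/-- Second order Taylor bound for `exp (i x)`, with a remainder of any order `q ∈ [2, 3]`. -/
lemma norm_cexp_mul_I_sub_taylor_le {q : ℝ} (hq : 2 ≤ q) (hq' : q ≤ 3) (x : ℝ) :
    ‖Complex.exp (x * Complex.I) - (1 + x * Complex.I - x ^ 2 / 2)‖ ≤ 4 * |x| ^ q := by
  have hsum : (1 + x * Complex.I - x ^ 2 / 2 : ℂ) =
      ∑ m ∈ Finset.range 3, (x * Complex.I) ^ m / m.factorial := by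
    simp only [Finset.sum_range_succ, Finset.sum_range_zero, Nat.factorial, mul_pow,
      Complex.I_sq]
    norm_num
    ring
  have hnorm : ‖(x * Complex.I : ℂ)‖ = |x| := by simp
  rcases le_or_gt |x| 1 with hx | hx
  · rw [hsum]
    have h := Complex.exp_bound (hnorm.le.trans hx) (n := 3) (by norm_num)
    refine h.trans ?_
    rw [hnorm]
    have h3 : |x| ^ 3 ≤ |x| ^ q := by
      rw [← Real.rpow_natCast]
      rcases eq_or_lt_of_le (abs_nonneg x) with h0 | h0
      · rw [← h0, Real.zero_rpow (by norm_num), Real.zero_rpow (by linarith)]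
      · exact Real.rpow_le_rpow_of_exponent_ge h0 hx (by exact_mod_cast hq')
    have : 0 ≤ |x| ^ 3 := by positivity
    norm_num [Nat.factorial]
    linarith
  -- For `|x| > 1` no cancellation is needed: each term is at most a multiple of `|x|²`.
  · have h2 : |x| ^ 2 ≤ |x| ^ q := by
      rw [← Real.rpow_natCast]
      exact Real.rpow_le_rpow_of_exponent_le hx.le (by exact_mod_cast hq)
    have h4 : ‖(1 + x * Complex.I - x ^ 2 / 2 : ℂ)‖ ≤ 1 + |x| + |x| ^ 2 / 2 := by
      refine (norm_sub_le _ _).trans (add_le_add ((norm_add_le _ _).trans ?_) ?_)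
      · simp
      · simp
    calc _ ≤ ‖Complex.exp (x * Complex.I)‖ + ‖(1 + x * Complex.I - x ^ 2 / 2 : ℂ)‖ :=
          norm_sub_le _ _
      _ ≤ 1 + (1 + |x| + |x| ^ 2 / 2) := by
          rw [Complex.norm_exp_ofReal_mul_I]
          linarith
      _ ≤ 4 * |x| ^ 2 := by nlinarith
      _ ≤ _ := by linarith

lemma abs_rpow_le_one_add {a b : ℝ} (ha : 0 ≤ a) (hab : a ≤ b) (x : ℝ) :
    |x| ^ a ≤ 1 + |x| ^ b := by
  have hb : 0 ≤ |x| ^ b := by positivity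
  rcases le_total |x| 1 with h | h
  · have := Real.rpow_le_one (abs_nonneg x) h ha
    linarith
  · have := Real.rpow_le_rpow_of_exponent_le h hab
    linarith

lemma integrable_of_integrable_abs_rpow {Ω : Type*} [MeasurableSpace Ω] {μ : Measure Ω}
    [IsFiniteMeasure μ] {f : Ω → ℝ} (hf : Measurable f) {a b : ℝ} (ha : 0 ≤ a) (hab : a ≤ b)
    (h : Integrable (fun x => |f x| ^ b) μ) : Integrable (fun x => |f x| ^ a) μ := by
  refine Integrable.mono' ((integrable_const 1).add h)
    (by fun_prop) (ae_of_all _ fun x => ?_)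
  rw [Real.norm_of_nonneg (by positivity)]
  exact abs_rpow_le_one_add ha hab _

lemma memLp_two_of_integrable_abs_rpow {Ω : Type*} [MeasurableSpace Ω] {μ : Measure Ω}
    [IsFiniteMeasure μ] {f : Ω → ℝ} (hf : Measurable f) {q : ℝ} (hq : 2 ≤ q)
    (h : Integrable (fun x => |f x| ^ q) μ) : MemLp f 2 μ := by
  rw [memLp_two_iff_integrable_sq hf.aestronglyMeasurable]
  have := integrable_of_integrable_abs_rpow hf zero_le_two hq h
  simpa using this

/-- A law on the line that is centred, has unit variance and a `q`-th absolute moment at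
most `C`. -/
structure IsStandardised (q C : ℝ) (μ : Measure ℝ) : Prop where
  integrable : Integrable (fun x => |x| ^ q) μ
  mean : ∫ x, x ∂μ = 0
  sq : ∫ x, x ^ 2 ∂μ = 1
  moment : ∫ x, |x| ^ q ∂μ ≤ C

/-- Integrate the Taylor bound; mean zero and unit variance evaluate the quadratic part. The
exponent `p` is separate from `q` because the Taylor bound stops at order three while `q` may be
larger. The constant depends on the law only through `C`. -/
lemma IsStandardised.norm_charFun_sub_le {q C : ℝ} {μ : Measure ℝ} [IsProbabilityMeasure μ]
    (h : IsStandardised q C μ) {p : ℝ} (hp : 2 ≤ p) (hp' : p ≤ 3) (hpq : p ≤ q) (s : ℝ) :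
    ‖charFun μ s - (1 - s ^ 2 / 2)‖ ≤ 4 * (1 + C) * |s| ^ p := by
  have hL2 : MemLp (fun x : ℝ => x) 2 μ :=
    memLp_two_of_integrable_abs_rpow measurable_id (hp.trans hpq) h.integrable
  have hi1 : Integrable (fun x : ℝ => x) μ := hL2.integrable (by norm_num)
  have hi2 : Integrable (fun x : ℝ => x ^ 2) μ := hL2.integrable_sq
  have hip : Integrable (fun x : ℝ => |x| ^ p) μ :=
    integrable_of_integrable_abs_rpow measurable_id (by linarith) hpq h.integrable
  have hie : Integrable (fun x : ℝ => Complex.exp (((x * s : ℝ) : ℂ) * Complex.I)) μ := by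
    refine Integrable.mono' (integrable_const 1) (by fun_prop) (ae_of_all _ fun x => ?_)
    rw [Complex.norm_exp_ofReal_mul_I]
  have hic : Integrable (fun x : ℝ => (1 + ((x * s : ℝ) : ℂ) * Complex.I -
      ((x * s : ℝ) : ℂ) ^ 2 / 2)) μ := by
    refine ((integrable_const _).add ?_).sub ?_
    · exact ((hi1.mul_const s).ofReal).mul_const _
    · have := ((hi2.mul_const (s ^ 2 / 2)).ofReal (𝕜 := ℂ))
      refine this.congr (ae_of_all _ fun x => ?_)
      simp only [RCLike.ofReal_eq_complex_ofReal]
      push_cast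
      ring
  have hint : ∫ x : ℝ, (1 + ((x * s : ℝ) : ℂ) * Complex.I - ((x * s : ℝ) : ℂ) ^ 2 / 2) ∂μ =
      (1 - s ^ 2 / 2 : ℂ) := by
    have e : ∀ x : ℝ, ((1 : ℂ) + ((x * s : ℝ) : ℂ) * Complex.I - ((x * s : ℝ) : ℂ) ^ 2 / 2) =
        (1 : ℂ) + ((x : ℝ) : ℂ) * (s * Complex.I) - ((x ^ 2 : ℝ) : ℂ) * (s ^ 2 / 2) := by
      intro x
      push_cast
      ring
    simp_rw [e]
    have hi1' : Integrable (fun x : ℝ => (x : ℂ)) μ := hi1.ofReal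
    have hi2' : Integrable (fun x : ℝ => ((x ^ 2 : ℝ) : ℂ)) μ := hi2.ofReal
    have hlin : Integrable (fun x : ℝ => (1 : ℂ) + (x : ℂ) * (s * Complex.I)) μ :=
      (integrable_const _).add (hi1'.mul_const _)
    rw [integral_sub hlin (hi2'.mul_const _),
      integral_add (integrable_const _) (hi1'.mul_const _), integral_mul_const,
      integral_mul_const, integral_complex_ofReal, integral_complex_ofReal, h.mean, h.sq]
    simp
  have hchar : charFun μ s = ∫ x : ℝ, Complex.exp (((x * s : ℝ) : ℂ) * Complex.I) ∂μ := by
    rw [charFun_apply_real]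
    congr 1
    ext x
    push_cast
    ring_nf
  rw [hchar, ← hint, ← integral_sub hie hic]
  calc _ ≤ ∫ x : ℝ, 4 * |s| ^ p * |x| ^ p ∂μ := by
        refine norm_integral_le_of_norm_le (hip.const_mul _) (ae_of_all _ fun x => ?_)
        refine (norm_cexp_mul_I_sub_taylor_le hp hp' (x * s)).trans_eq ?_
        rw [abs_mul, Real.mul_rpow (abs_nonneg _) (abs_nonneg _)]
        ring
    _ ≤ ∫ x : ℝ, 4 * |s| ^ p * (1 + |x| ^ q) ∂μ := by
        refine integral_mono (hip.const_mul _)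
          (((integrable_const 1).add h.integrable).const_mul _) fun x => ?_
        exact mul_le_mul_of_nonneg_left (abs_rpow_le_one_add (by linarith) hpq x) (by positivity)
    _ = 4 * |s| ^ p * (1 + ∫ x : ℝ, |x| ^ q ∂μ) := by
        rw [integral_const_mul, integral_add (integrable_const 1) h.integrable]
        simp
    _ ≤ _ := by
        have := h.moment
        have h0 : 0 ≤ 4 * |s| ^ p := by positivity
        nlinarith

/-- The law of the normalised sum of `n` independent variables with law `μ`. -/
noncomputable def normalisedSumLaw (μ : ProbabilityMeasure ℝ) (n : ℕ) : ProbabilityMeasure ℝ :=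
  ⟨(Measure.pi fun _ : Fin n => (μ : Measure ℝ)).map fun w => (√(n : ℝ))⁻¹ * ∑ i, w i,
    Measure.isProbabilityMeasure_map (by fun_prop)⟩

lemma charFun_normalisedSumLaw (μ : ProbabilityMeasure ℝ) (n : ℕ) (t : ℝ) :
    charFun (normalisedSumLaw μ n : Measure ℝ) t =
      charFun (μ : Measure ℝ) ((√(n : ℝ))⁻¹ * t) ^ n := by
  rw [normalisedSumLaw, ProbabilityMeasure.coe_mk, charFun_map_mul_comp (by fun_prop),
    charFun_map_sum_pi_eq_prod]
  simp

/-- The law may change with `n`, because the error in `1 - t²/(2n)` is bounded through `q`, `C` and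
`t` alone. This freedom yields uniformity below. -/
lemma tendsto_normalisedSumLaw {q C : ℝ} (hq : 2 < q) {μ : ℕ → ProbabilityMeasure ℝ}
    (h : ∀ n, IsStandardised q C (μ n : Measure ℝ)) :
    Tendsto (fun n => normalisedSumLaw (μ n) n) atTop
      (𝓝 (⟨gaussianReal 0 1, inferInstance⟩ : ProbabilityMeasure ℝ)) := by
  refine ProbabilityMeasure.tendsto_of_tendsto_charFun fun t => ?_
  simp_rw [charFun_normalisedSumLaw, ProbabilityMeasure.coe_mk, charFun_gaussianReal]
  have hlim : Complex.exp ((t : ℂ) * (0 : ℝ) * Complex.I - ((1 : NNReal) : ℝ) * t ^ 2 / 2) =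
      Complex.exp (-t ^ 2 / 2) := by
    congr 1
    push_cast
    ring
  rw [hlim]
  apply Complex.tendsto_pow_exp_of_isLittleO_sub_add_div
  set p := min q 3 with hp
  have hp2 : 2 < p := lt_min hq (by norm_num)
  have hbound : ∀ n : ℕ, 0 < n → ‖charFun (μ n : Measure ℝ) ((√(n : ℝ))⁻¹ * t) -
      (1 + -(t : ℂ) ^ 2 / 2 / n)‖ ≤ 4 * (1 + C) * |t| ^ p * (n : ℝ) ^ (-(p / 2)) := by
    intro n hn
    have hn' : (0 : ℝ) < n := by exact_mod_cast hn
    have h1 := (h n).norm_charFun_sub_le hp2.le (min_le_right _ _) (min_le_left _ _)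
      ((√(n : ℝ))⁻¹ * t)
    have e1 : (1 + -(t : ℂ) ^ 2 / 2 / n) = 1 - (((√(n : ℝ))⁻¹ * t : ℝ) : ℂ) ^ 2 / 2 := by
      rw [← Complex.ofReal_pow ((√(n : ℝ))⁻¹ * t), mul_pow, inv_pow, Real.sq_sqrt hn'.le]
      push_cast
      ring
    rw [e1]
    refine h1.trans_eq ?_
    rw [abs_mul, Real.mul_rpow (abs_nonneg _) (abs_nonneg _), abs_of_pos (by positivity),
      Real.sqrt_eq_rpow, ← Real.rpow_neg hn'.le, ← Real.rpow_mul hn'.le]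
    ring_nf
  refine Asymptotics.isLittleO_of_tendsto' ?_ ?_ |>.trans_isBigO (Asymptotics.isBigO_refl _ _)
  · filter_upwards [eventually_gt_atTop 0] with n hn h0
    have : (n : ℂ) ≠ 0 := by exact_mod_cast hn.ne'
    exact absurd h0 (by simp [this])
  rw [tendsto_zero_iff_norm_tendsto_zero]
  -- The error of order `n^(-p/2)` is `o(1/n)` exactly because `p > 2`.
  have hlim2 : Tendsto (fun n : ℕ => 4 * (1 + C) * |t| ^ p * (n : ℝ) ^ (-(p / 2 - 1))) atTop
      (𝓝 0) := by
    have := (tendsto_rpow_neg_atTop (show 0 < p / 2 - 1 by linarith)).comp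
      (tendsto_natCast_atTop_atTop (R := ℝ))
    simpa using this.const_mul (4 * (1 + C) * |t| ^ p)
  refine squeeze_zero' (Eventually.of_forall fun n => norm_nonneg _) ?_ hlim2
  filter_upwards [eventually_gt_atTop 0] with n hn
  have hn' : (0 : ℝ) < n := by exact_mod_cast hn
  have e2 : (n : ℝ) ^ (-(p / 2 - 1)) = (n : ℝ) ^ (-(p / 2)) * n := by
    conv_rhs => rw [← Real.rpow_one (n : ℝ), ← Real.rpow_mul hn'.le, one_mul,
      ← Real.rpow_add hn']
    ring_nf
  rw [norm_div, e2, norm_div, norm_one, Complex.norm_natCast, div_div_eq_mul_div, div_one,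
    ← mul_assoc]
  exact mul_le_mul_of_nonneg_right (hbound n hn) hn'.le

/-- Central limit theorem for normalised sums, uniform over the standardised laws with a bounded
moment of order larger than two. -/
lemma eventually_forall_isStandardised {q : ℝ} (hq : 2 < q) (C : ℝ) {ε : ℝ} (hε : 0 < ε) :
    ∀ᶠ n : ℕ in atTop, ∀ μ : ProbabilityMeasure ℝ, IsStandardised q C (μ : Measure ℝ) →
      ∀ t, |(normalisedSumLaw μ n : Measure ℝ).real (Set.Iic t) - stdNormalCDF t| ≤ ε := by
  by_contra hcon
  rw [not_eventually] at hcon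
  obtain ⟨n₀, hn₀⟩ := hcon.exists
  push Not at hn₀
  obtain ⟨μ₀, hμ₀, -⟩ := hn₀
  have hex : ∀ n : ℕ, ∃ μ : ProbabilityMeasure ℝ, IsStandardised q C (μ : Measure ℝ) ∧
      ((∀ t, |(normalisedSumLaw μ n : Measure ℝ).real (Set.Iic t) - stdNormalCDF t| ≤ ε) →
        ∀ μ : ProbabilityMeasure ℝ, IsStandardised q C (μ : Measure ℝ) →
          ∀ t, |(normalisedSumLaw μ n : Measure ℝ).real (Set.Iic t) - stdNormalCDF t| ≤ ε) := by
    intro n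
    by_cases hn : ∀ μ : ProbabilityMeasure ℝ, IsStandardised q C (μ : Measure ℝ) →
      ∀ t, |(normalisedSumLaw μ n : Measure ℝ).real (Set.Iic t) - stdNormalCDF t| ≤ ε
    · exact ⟨μ₀, hμ₀, fun _ => hn⟩
    · push Not at hn
      obtain ⟨μ, hμ, t, ht⟩ := hn
      exact ⟨μ, hμ, fun h => absurd (h t) (not_le.2 ht)⟩
  choose μ hμ hbad using hex
  have hlim := tendsto_normalisedSumLaw hq hμ
  have hunif := eventually_abs_sub_stdNormalCDF_le (l := atTop)
    (F := fun n t => (normalisedSumLaw (μ n) n : Measure ℝ).real (Set.Iic t))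
    (fun n s t hst => measureReal_mono (Set.Iic_subset_Iic.2 hst)) (fun _ _ => measureReal_nonneg)
    (fun _ _ => measureReal_le_one) (fun t => ?_) hε
  · refine hcon ?_
    filter_upwards [hunif] with n hn
    exact not_not.2 (hbad n hn)
  · have h := ProbabilityMeasure.tendsto_measure_of_null_frontier_of_tendsto' hlim
      (E := Set.Iic t) (by
        rw [frontier_Iic]
        have := nullSingletonClass_gaussianReal (μ := 0) (one_ne_zero (α := NNReal))
        exact measure_singleton (μ := gaussianReal 0 1) t)
    rw [stdNormalCDF_eq_real]
    exact (ENNReal.tendsto_toReal (measure_ne_top _ _)).comp h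

/-! ### Sample means: Chebyshev's inequality and truncation. -/

section Sampling

variable {E : Type*} [MeasurableSpace E] {P : Measure E} [IsProbabilityMeasure P]

lemma normalisedSumLaw_map_Iic {g : E → ℝ} (hg : Measurable g) (n : ℕ) (t : ℝ) :
    (normalisedSumLaw ⟨P.map g, Measure.isProbabilityMeasure_map hg.aemeasurable⟩ n :
      Measure ℝ).real (Set.Iic t) =
      (Measure.pi fun _ : Fin n => P).real {w | (√(n : ℝ))⁻¹ * ∑ i, g (w i) ≤ t} := by
  have := Measure.isProbabilityMeasure_map (μ := P) hg.aemeasurable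
  change ((Measure.pi fun _ : Fin n => P.map g).map fun w =>
    (√(n : ℝ))⁻¹ * ∑ i, w i).real (Set.Iic t) = _
  rw [map_measureReal_apply (by fun_prop) measurableSet_Iic,
    ← Measure.pi_map_pi (fun _ => hg.aemeasurable),
    map_measureReal_apply (by fun_prop) (measurableSet_Iic.preimage (by fun_prop))]
  rfl

lemma integral_sampleMean {f : E → ℝ} (hf : Integrable f P) {n : ℕ} (hn : 0 < n) :
    ∫ w, (1 / (n : ℝ)) * ∑ i, f (w i) ∂(Measure.pi fun _ : Fin n => P) = ∫ x, f x ∂P := by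
  have hn' : (n : ℝ) ≠ 0 := by exact_mod_cast hn.ne'
  have hi : ∀ i : Fin n, Integrable (fun w : Fin n → E => f (w i))
      (Measure.pi fun _ : Fin n => P) := fun i =>
    (measurePreserving_eval (fun _ : Fin n => P) i).integrable_comp_of_integrable hf
  rw [integral_const_mul, integral_finsetSum _ fun i _ => hi i]
  have : ∀ i : Fin n, ∫ w, f (w i) ∂(Measure.pi fun _ : Fin n => P) = ∫ x, f x ∂P :=
    fun i => integral_comp_eval (μ := fun _ : Fin n => P) hf.aestronglyMeasurable
  simp only [this, Finset.sum_const, Finset.card_univ, Fintype.card_fin, nsmul_eq_mul]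
  field_simp

/-- Chebyshev's inequality for the mean of an independent sample. -/
lemma measureReal_abs_sampleMean_sub_ge_le {f : E → ℝ} (hf : MemLp f 2 P) {n : ℕ} (hn : 0 < n)
    {h : ℝ} (hh : 0 < h) :
    (Measure.pi fun _ : Fin n => P).real
      {w | h ≤ |(1 / (n : ℝ)) * ∑ i, f (w i) - ∫ x, f x ∂P|} ≤ Var[f; P] / (n * h ^ 2) := by
  have hn' : (0 : ℝ) < n := by exact_mod_cast hn
  have hL : MemLp (fun w : Fin n → E => (1 / (n : ℝ)) * ∑ i, f (w i)) 2
      (Measure.pi fun _ : Fin n => P) := by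
    have hs : MemLp (fun w : Fin n → E => ∑ i, f (w i)) 2 (Measure.pi fun _ : Fin n => P) :=
      memLp_finsetSum _ fun i _ =>
        hf.comp_measurePreserving (measurePreserving_eval (fun _ : Fin n => P) i)
    exact hs.const_mul _
  have hv : Var[fun w : Fin n → E => (1 / (n : ℝ)) * ∑ i, f (w i);
      Measure.pi fun _ : Fin n => P] = Var[f; P] / n := by
    have h1 := variance_sum_pi (μ := fun _ : Fin n => P) (X := fun _ => f) fun _ => hf
    rw [variance_const_mul]
    have e : (fun w : Fin n → E => ∑ i, f (w i)) = ∑ i, fun w : Fin n → E => f (w i) := by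
      ext w
      simp
    rw [e, h1]
    simp only [Finset.sum_const, Finset.card_univ, Fintype.card_fin, nsmul_eq_mul]
    field_simp
  have h2 := meas_ge_le_variance_div_sq hL hh
  rw [integral_sampleMean (hf.integrable (by norm_num)) hn, hv] at h2
  rw [measureReal_def]
  refine ENNReal.toReal_le_of_le_ofReal
    (div_nonneg (variance_nonneg _ _) (by positivity)) (h2.trans_eq ?_)
  rw [div_div]

/-- A truncated law of large numbers for nonnegative variables with a moment of order `1 + r`. -/
lemma measureReal_abs_sampleMean_sub_ge_le_of_nonneg {g : E → ℝ} (hg : Measurable g)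
    (hg0 : ∀ x, 0 ≤ g x) {r C : ℝ} (hr : 0 < r)
    (hint : Integrable (fun x => g x ^ (1 + r)) P) (hC : ∫ x, g x ^ (1 + r) ∂P ≤ C)
    {M h : ℝ} (hM : 0 < M) (hh : 0 < h) (hMh : C / M ^ r < h / 3) {n : ℕ} (hn : 0 < n) :
    (Measure.pi fun _ : Fin n => P).real
      {w | h ≤ |(1 / (n : ℝ)) * ∑ i, g (w i) - ∫ x, g x ∂P|} ≤
        M ^ 2 / (n * (h / 3) ^ 2) + C / M ^ r / (h / 3) := by
  have hn' : (0 : ℝ) < n := by exact_mod_cast hn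
  have hMr : 0 < M ^ r := by positivity
  set g₁ : E → ℝ := fun x => min (g x) M with hg₁
  set g₂ : E → ℝ := fun x => g x - min (g x) M with hg₂
  have hg₁m : Measurable g₁ := by fun_prop
  have hg₂m : Measurable g₂ := by fun_prop
  -- The bounded part `g₁` is handled by Chebyshev; the excess `g₂` lives on `g ≥ M` and is paid for
  -- by the moment of order `1 + r`, using Markov's inequality.
  have hg₂0 : ∀ x, 0 ≤ g₂ x := fun x => sub_nonneg.2 (min_le_left _ _)
  have hg₂le : ∀ x, g₂ x ≤ g x ^ (1 + r) / M ^ r := by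
    intro x
    have h0 := hg0 x
    simp only [hg₂]
    rcases le_total (g x) M with hx | hx
    · rw [min_eq_left hx, sub_self]
      positivity
    · rw [min_eq_right hx, le_div_iff₀ hMr]
      have hgx : 0 < g x := hM.trans_le hx
      rw [Real.rpow_add hgx, Real.rpow_one]
      have := Real.rpow_le_rpow hM.le hx hr.le
      exact mul_le_mul (by linarith) this hMr.le h0
  have hg₁L : MemLp g₁ 2 P := by
    refine MemLp.of_bound hg₁m.aestronglyMeasurable M (ae_of_all _ fun x => ?_)
    rw [Real.norm_of_nonneg (le_min (hg0 x) hM.le)]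
    exact min_le_right _ _
  have hg₁i : Integrable g₁ P := hg₁L.integrable (by norm_num)
  have hg₂i : Integrable g₂ P := by
    refine Integrable.mono' (hint.div_const (M ^ r)) hg₂m.aestronglyMeasurable
      (ae_of_all _ fun x => ?_)
    rw [Real.norm_of_nonneg (hg₂0 x)]
    exact hg₂le x
  have hEg₂ : ∫ x, g₂ x ∂P ≤ C / M ^ r := by
    calc _ ≤ ∫ x, g x ^ (1 + r) / M ^ r ∂P := integral_mono hg₂i (hint.div_const _) hg₂le
      _ ≤ _ := by
        rw [integral_div]
        gcongr
  have hEg₂0 : 0 ≤ ∫ x, g₂ x ∂P := integral_nonneg hg₂0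
  have hEg : ∫ x, g x ∂P = ∫ x, g₁ x ∂P + ∫ x, g₂ x ∂P := by
    rw [← integral_add hg₁i hg₂i]
    simp [hg₁, hg₂]
  have hvar : Var[g₁; P] ≤ M ^ 2 := by
    have hb := variance_le_sq_of_bounded (μ := P) (X := g₁) (a := 0) (b := M)
      (ae_of_all _ fun x => ⟨le_min (hg0 x) hM.le, min_le_right _ _⟩) hg₁m.aemeasurable
    nlinarith
  -- Off the union, the sample mean of `g₂` and its expectation both lie in `[0, h / 3)`, so the
  -- excess contributes less than `h / 3` to the deviation.
  have hsub : {w : Fin n → E | h ≤ |(1 / (n : ℝ)) * ∑ i, g (w i) - ∫ x, g x ∂P|} ⊆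
      {w | h / 3 ≤ |(1 / (n : ℝ)) * ∑ i, g₁ (w i) - ∫ x, g₁ x ∂P|} ∪
        {w | h / 3 ≤ (1 / (n : ℝ)) * ∑ i, g₂ (w i)} := by
    intro w hw
    simp only [Set.mem_ofPred_eq, Set.mem_union] at hw ⊢
    by_contra! hcon
    obtain ⟨c1, c2⟩ := hcon
    have e : (1 / (n : ℝ)) * ∑ i, g (w i) =
        (1 / (n : ℝ)) * ∑ i, g₁ (w i) + (1 / (n : ℝ)) * ∑ i, g₂ (w i) := by
      rw [← mul_add, ← Finset.sum_add_distrib]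
      simp [hg₁, hg₂]
    have c3 : 0 ≤ (1 / (n : ℝ)) * ∑ i, g₂ (w i) :=
      mul_nonneg (by positivity) (Finset.sum_nonneg fun i _ => hg₂0 _)
    rw [e, hEg] at hw
    rw [abs_lt] at c1
    have : |(1 / (n : ℝ)) * ∑ i, g₁ (w i) + (1 / (n : ℝ)) * ∑ i, g₂ (w i) -
        (∫ x, g₁ x ∂P + ∫ x, g₂ x ∂P)| < h := by
      rw [abs_lt]
      constructor <;> linarith
    linarith
  refine (measureReal_mono hsub).trans ((measureReal_union_le _ _).trans (add_le_add ?_ ?_))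
  · refine (measureReal_abs_sampleMean_sub_ge_le hg₁L hn (by positivity)).trans ?_
    gcongr
  · have hmi : Integrable (fun w : Fin n → E => (1 / (n : ℝ)) * ∑ i, g₂ (w i))
        (Measure.pi fun _ : Fin n => P) := by
      refine Integrable.const_mul (integrable_finsetSum _ fun i _ => ?_) _
      exact (measurePreserving_eval (fun _ : Fin n => P) i).integrable_comp_of_integrable hg₂i
    have hmk := mul_meas_ge_le_integral_of_nonneg
      (ae_of_all _ fun w => mul_nonneg (by positivity) (Finset.sum_nonneg fun i _ => hg₂0 _))
      hmi (h / 3)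
    rw [integral_sampleMean hg₂i hn] at hmk
    rw [le_div_iff₀ (by positivity), mul_comm]
    exact hmk.trans hEg₂

end Sampling

/-! ### Central moments and standardisation. -/

lemma abs_sub_rpow_le {q : ℝ} (hq : 0 ≤ q) (x m : ℝ) :
    |x - m| ^ q ≤ 2 ^ q * (|x| ^ q + |m| ^ q) := by
  have h1 : |x - m| ≤ 2 * max |x| |m| := by
    have := abs_sub x m
    have := le_max_left |x| |m|
    have := le_max_right |x| |m|
    linarith
  have h2 : max |x| |m| ^ q ≤ |x| ^ q + |m| ^ q := by
    have : 0 ≤ |x| ^ q := by positivity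
    have : 0 ≤ |m| ^ q := by positivity
    rcases max_cases |x| |m| with ⟨h, _⟩ | ⟨h, _⟩ <;> rw [h] <;> linarith
  calc |x - m| ^ q ≤ (2 * max |x| |m|) ^ q := Real.rpow_le_rpow (abs_nonneg _) h1 hq
    _ = 2 ^ q * max |x| |m| ^ q := Real.mul_rpow zero_le_two (le_max_of_le_left (abs_nonneg _))
    _ ≤ _ := by gcongr

/-- A bound for the `q`-th absolute central moment in terms of a bound `C` for the `q`-th absolute
moment. -/
noncomputable def centralMomentBound (q C : ℝ) : ℝ := 2 ^ q * (C + (1 + C) ^ q)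

section Moments

variable {E : Type*} [MeasurableSpace E] {P : Measure E} [IsProbabilityMeasure P]
  {f : E → ℝ} {q C : ℝ}

lemma integrable_central_moment (hf : Measurable f) (hq : 0 ≤ q)
    (hint : Integrable (fun x => |f x| ^ q) P) (m : ℝ) :
    Integrable (fun x => |f x - m| ^ q) P := by
  refine Integrable.mono' ((hint.add (integrable_const (|m| ^ q))).const_mul (2 ^ q))
    (by fun_prop) (ae_of_all _ fun x => ?_)
  rw [Real.norm_of_nonneg (by positivity)]
  exact abs_sub_rpow_le hq _ _

lemma integral_central_moment_le (hf : Measurable f) (hq : 1 ≤ q)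
    (hint : Integrable (fun x => |f x| ^ q) P) (hC : ∫ x, |f x| ^ q ∂P ≤ C) :
    ∫ x, |f x - ∫ y, f y ∂P| ^ q ∂P ≤ centralMomentBound q C := by
  have h1 : Integrable (fun x => |f x|) P := by
    simpa using integrable_of_integrable_abs_rpow hf zero_le_one hq hint
  have hm : |∫ y, f y ∂P| ≤ 1 + C := by
    calc _ ≤ ∫ y, |f y| ∂P := abs_integral_le_integral_abs
      _ ≤ ∫ y, (1 + |f y| ^ q) ∂P := by
        refine integral_mono h1 ((integrable_const 1).add hint) fun x => ?_
        simpa using abs_rpow_le_one_add zero_le_one hq (f x)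
      _ ≤ _ := by
        rw [integral_add (integrable_const 1) hint]
        simpa using hC
  calc _ ≤ ∫ x, 2 ^ q * (|f x| ^ q + |∫ y, f y ∂P| ^ q) ∂P :=
        integral_mono (integrable_central_moment hf (by linarith) hint _)
          ((hint.add (integrable_const _)).const_mul _) fun x => abs_sub_rpow_le (by linarith) _ _
    _ = 2 ^ q * (∫ x, |f x| ^ q ∂P + |∫ y, f y ∂P| ^ q) := by
        rw [integral_const_mul, integral_add hint (integrable_const _)]
        simp
    _ ≤ _ := by
        unfold centralMomentBound
        gcongr

/-- The lower bound on the variance prevents division by `σ` from inflating the `q`-th moment, so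
all standardised laws of the family share one moment constant. -/
lemma isStandardised_map (hf : Measurable f) (hq : 2 ≤ q)
    (hint : Integrable (fun x => |f x| ^ q) P) (hC : ∫ x, |f x| ^ q ∂P ≤ C)
    {c : ℝ} (hc : 0 < c) (hvar : c < Var[f; P]) :
    IsStandardised q (centralMomentBound q C / √c ^ q)
      (P.map fun x => (f x - ∫ y, f y ∂P) / √Var[f; P]) := by
  have hV : 0 < Var[f; P] := hc.trans hvar
  have hs : 0 < √Var[f; P] := Real.sqrt_pos.2 hV
  have hgm : Measurable fun x => (f x - ∫ y, f y ∂P) / √Var[f; P] := by fun_prop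
  have hfL : MemLp f 2 P := memLp_two_of_integrable_abs_rpow hf hq hint
  have hfi : Integrable f P := hfL.integrable (by norm_num)
  have habs : ∀ x, |(f x - ∫ y, f y ∂P) / √Var[f; P]| ^ q =
      |f x - ∫ y, f y ∂P| ^ q / √Var[f; P] ^ q := by
    intro x
    rw [abs_div, abs_of_pos hs, Real.div_rpow (abs_nonneg _) hs.le]
  have hci := integrable_central_moment hf (by linarith) hint (∫ y, f y ∂P)
  have hcm := integral_central_moment_le hf (by linarith) hint hC
  have habsm : Measurable fun x : ℝ => |x| ^ q := by fun_prop
  refine ⟨?_, ?_, ?_, ?_⟩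
  · rw [integrable_map_measure habsm.aestronglyMeasurable hgm.aemeasurable]
    refine (hci.div_const (√Var[f; P] ^ q)).congr (ae_of_all _ fun x => ?_)
    exact (habs x).symm
  · rw [integral_map hgm.aemeasurable (by fun_prop), integral_div,
      integral_sub hfi (integrable_const _)]
    simp
  · rw [integral_map hgm.aemeasurable (by fun_prop)]
    simp_rw [div_pow, Real.sq_sqrt hV.le]
    rw [integral_div, ← variance_eq_integral hf.aemeasurable, div_self hV.ne']
  · rw [integral_map hgm.aemeasurable habsm.aestronglyMeasurable]
    simp_rw [habs]
    rw [integral_div]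
    have : 0 ≤ ∫ x, |f x - ∫ y, f y ∂P| ^ q ∂P := integral_nonneg fun x => by positivity
    have h1 : √c ^ q ≤ √Var[f; P] ^ q :=
      Real.rpow_le_rpow (Real.sqrt_nonneg _) (Real.sqrt_le_sqrt hvar.le) (by linarith)
    exact div_le_div₀ (this.trans hcm) hcm (by positivity) h1

lemma variance_le_central_moment (hf : Measurable f) (hq : 2 ≤ q)
    (hint : Integrable (fun x => |f x| ^ q) P) (hC : ∫ x, |f x| ^ q ∂P ≤ C) :
    Var[f; P] ≤ 1 + centralMomentBound q C := by
  have hci := integrable_central_moment hf (by linarith) hint (∫ y, f y ∂P)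
  have hcm := integral_central_moment_le hf (by linarith) hint hC
  have h2 := integrable_of_integrable_abs_rpow (f := fun x => f x - ∫ y, f y ∂P)
    (by fun_prop) zero_le_two hq hci
  rw [variance_eq_integral hf.aemeasurable]
  calc _ ≤ ∫ x, (1 + |f x - ∫ y, f y ∂P| ^ q) ∂P := by
        refine integral_mono (by simpa using h2) ((integrable_const 1).add hci) fun x => ?_
        simpa using abs_rpow_le_one_add zero_le_two hq (f x - ∫ y, f y ∂P)
    _ ≤ _ := by
        rw [integral_add (integrable_const 1) hci]
        simpa using hcm

end Moments

/-- Central limit theorem and laws of large numbers for the first two moments, uniformly over the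
laws with variance bounded below and a bounded moment of order larger than two. -/
lemma eventually_forall_sample_limits {q c C : ℝ} (hq : 2 < q) (hc : 0 < c) (hC : 0 < C)
    {h ε : ℝ} (hh : 0 < h) (hε : 0 < ε) :
    ∀ᶠ n : ℕ in atTop, ∀ (E : Type) [MeasurableSpace E] (P : Measure E) [IsProbabilityMeasure P]
      (f : E → ℝ), Measurable f → Integrable (fun x => |f x| ^ q) P → ∫ x, |f x| ^ q ∂P ≤ C →
      c < Var[f; P] →
      (∀ t, |(Measure.pi fun _ : Fin n => P).real {w | (√(n : ℝ))⁻¹ *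
        ∑ i, (f (w i) - ∫ x, f x ∂P) / √Var[f; P] ≤ t} - stdNormalCDF t| ≤ ε) ∧
      (Measure.pi fun _ : Fin n => P).real
        {w | h ≤ |(1 / (n : ℝ)) * ∑ i, f (w i) - ∫ x, f x ∂P|} ≤ ε ∧
      (Measure.pi fun _ : Fin n => P).real
        {w | h ≤ |(1 / (n : ℝ)) * ∑ i, (f (w i) - ∫ x, f x ∂P) ^ 2 - Var[f; P]|} ≤ ε := by
  set K := centralMomentBound q C with hK
  have hK0 : 0 < K := by rw [hK, centralMomentBound]; positivity
  -- The squared centred variable has a moment of order `1 + r = q / 2`. Only slightly more than two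
  -- moments of `f` are available, so Chebyshev cannot be applied to the squares directly.
  have hr : 0 < q / 2 - 1 := by linarith
  -- The `1` in the minimum meets the hypothesis of the truncation lemma, the `ε / 2` bounds its
  -- Markov term.
  obtain ⟨M, hM0, hM⟩ : ∃ M : ℝ, 0 < M ∧ K / M ^ (q / 2 - 1) < h / 3 * min 1 (ε / 2) := by
    have ht : Tendsto (fun M : ℝ => K / M ^ (q / 2 - 1)) atTop (𝓝 0) :=
      (tendsto_rpow_atTop hr).const_div_atTop K
    have hpos : 0 < h / 3 * min 1 (ε / 2) := by positivity
    obtain ⟨M, h1, h2⟩ := ((eventually_gt_atTop 0).and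
      (ht.eventually (eventually_lt_nhds hpos))).exists
    exact ⟨M, h1, h2⟩
  have hM1 : K / M ^ (q / 2 - 1) < h / 3 :=
    hM.trans_le (mul_le_of_le_one_right (by positivity) (min_le_left _ _))
  have hM2 : K / M ^ (q / 2 - 1) / (h / 3) ≤ ε / 2 := by
    rw [div_le_iff₀ (by positivity), mul_comm]
    exact hM.le.trans (mul_le_mul_of_nonneg_left (min_le_right _ _) (by positivity))
  have hsmall : ∀ a b : ℝ, 0 < b → ∀ ε' : ℝ, 0 < ε' →
      ∀ᶠ n : ℕ in atTop, a / ((n : ℝ) * b) ≤ ε' := by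
    intro a b hb ε' hε'
    have : Tendsto (fun n : ℕ => a / ((n : ℝ) * b)) atTop (𝓝 0) :=
      ((tendsto_natCast_atTop_atTop (R := ℝ)).atTop_mul_const hb).const_div_atTop a
    exact this.eventually (eventually_le_nhds hε')
  filter_upwards [eventually_forall_isStandardised hq (K / √c ^ q) hε,
    hsmall (1 + K) (h ^ 2) (by positivity) ε hε,
    hsmall (M ^ 2) ((h / 3) ^ 2) (by positivity) (ε / 2) (by positivity),
    eventually_gt_atTop 0] with n hclt hn1 hn2 hn E _ P _ f hf hint hCf hvar
  have hL2 : MemLp f 2 P := memLp_two_of_integrable_abs_rpow hf hq.le hint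
  refine ⟨fun t => ?_, ?_, ?_⟩
  · have hgm : Measurable fun x => (f x - ∫ y, f y ∂P) / √Var[f; P] := by fun_prop
    have := hclt ⟨_, Measure.isProbabilityMeasure_map hgm.aemeasurable⟩
      (isStandardised_map hf hq.le hint hCf hc hvar) t
    rwa [normalisedSumLaw_map_Iic hgm] at this
  · refine (measureReal_abs_sampleMean_sub_ge_le hL2 hn hh).trans (le_trans ?_ hn1)
    have := variance_le_central_moment hf hq.le hint hCf
    gcongr
  · have hpow : ∀ x, ((f x - ∫ y, f y ∂P) ^ 2) ^ (1 + (q / 2 - 1)) =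
        |f x - ∫ y, f y ∂P| ^ q := by
      intro x
      rw [← sq_abs, ← Real.rpow_natCast, ← Real.rpow_mul (abs_nonneg _)]
      congr 1
      push_cast
      ring
    have := measureReal_abs_sampleMean_sub_ge_le_of_nonneg (P := P) (C := K)
      (g := fun x => (f x - ∫ y, f y ∂P) ^ 2) (by fun_prop) (fun x => sq_nonneg _) hr
      (by simpa only [hpow] using integrable_central_moment hf (by linarith) hint _)
      (by simpa only [hpow] using integral_central_moment_le hf (by linarith) hint hCf)
      hM0 hh hM1 hn
    rw [← variance_eq_integral hf.aemeasurable] at this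
    linarith

/-! ### Population identities in the linear model. -/

section Model

variable {d : ℕ}

lemma measurable_resX (b : EuclideanSpace ℝ (Fin d)) : Measurable (resX b) := by
  unfold resX
  fun_prop

lemma measurable_resY (b : EuclideanSpace ℝ (Fin d)) : Measurable (resY b) := by
  unfold resY
  fun_prop

lemma measurable_epsXi (p : Params d) : Measurable (epsXi p) :=
  (measurable_resY _).mul (measurable_resX _)

variable {P : Measure (Obs d)}

lemma HasSecondMoments.memLp_inner (h : HasSecondMoments P) (v : EuclideanSpace ℝ (Fin d)) :
    MemLp (fun o : Obs d => inner ℝ v o.2.2) 2 P := h.2.2.const_inner v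

lemma HasSecondMoments.memLp_resX (h : HasSecondMoments P) (v : EuclideanSpace ℝ (Fin d)) :
    MemLp (resX v) 2 P := h.1.sub (h.memLp_inner v)

/-- The normal equations of a population least squares projection. -/
lemma IsLeastSquaresProjection.integral_mul_inner_eq_zero {W : Obs d → ℝ}
    {b : EuclideanSpace ℝ (Fin d)} (hb : IsLeastSquaresProjection P W b)
    (hP : HasSecondMoments P) (hW : MemLp W 2 P) (v : EuclideanSpace ℝ (Fin d)) :
    ∫ o, (W o - inner ℝ b o.2.2) * inner ℝ v o.2.2 ∂P = 0 := by
  have hr : MemLp (fun o : Obs d => W o - inner ℝ b o.2.2) 2 P := hW.sub (hP.memLp_inner b)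
  have hv := hP.memLp_inner v
  set A := ∫ o, (W o - inner ℝ b o.2.2) * inner ℝ v o.2.2 ∂P with hA
  set B := ∫ o : Obs d, (inner ℝ v o.2.2 : ℝ) ^ 2 ∂P with hB
  have hB0 : 0 ≤ B := integral_nonneg fun o => sq_nonneg _
  have hexp : ∀ t : ℝ, 0 ≤ t ^ 2 * B - 2 * t * A := by
    intro t
    have h := hb (b + t • v)
    have e : ∀ o : Obs d, (W o - inner ℝ (b + t • v) o.2.2) ^ 2 =
        ((W o - inner ℝ b o.2.2) ^ 2 - 2 * t * ((W o - inner ℝ b o.2.2) * inner ℝ v o.2.2)) +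
          t ^ 2 * (inner ℝ v o.2.2 : ℝ) ^ 2 := by
      intro o
      rw [inner_add_left, inner_smul_left]
      simp only [conj_trivial]
      ring
    simp_rw [e] at h
    have hi1 : Integrable (fun o : Obs d => (W o - inner ℝ b o.2.2) ^ 2) P := hr.integrable_sq
    have hi2 : Integrable (fun o : Obs d =>
        2 * t * ((W o - inner ℝ b o.2.2) * inner ℝ v o.2.2)) P :=
      (hr.integrable_mul hv).const_mul _
    have hi12 : Integrable (fun o : Obs d => (W o - inner ℝ b o.2.2) ^ 2 -
        2 * t * ((W o - inner ℝ b o.2.2) * inner ℝ v o.2.2)) P := hi1.sub hi2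
    rw [integral_add hi12 (hv.integrable_sq.const_mul _), integral_sub hi1 hi2,
      integral_const_mul, integral_const_mul] at h
    linarith
  -- The quadratic `t² B - 2 t A` would be negative at `t = A` if `B = 0`, and at its minimiser `t =
  -- A / B` otherwise.
  by_contra hne
  rcases eq_or_lt_of_le hB0 with hB0 | hB0
  · have := hexp A
    rw [← hB0] at this
    have : 0 < A * A := mul_self_pos.2 hne
    linarith
  · have h1 := hexp (A / B)
    have h2 : (A / B) ^ 2 * B - 2 * (A / B) * A = -(A * A / B) := by
      field_simp
      ring
    have h3 : 0 < A * A / B := div_pos (mul_self_pos.2 hne) hB0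
    linarith

variable [IsProbabilityMeasure P]

/-- The regression error is uncorrelated with the residual of `X` on `Z`. -/
lemma IsLinearModel.integral_mul_resX_eq_zero {β : ℝ} {γ : EuclideanSpace ℝ (Fin d)}
    (h : IsLinearModel P β γ) (hP : HasSecondMoments P) (η : EuclideanSpace ℝ (Fin d)) :
    ∫ o : Obs d, (o.2.1 - β * o.1 - inner ℝ γ o.2.2) * resX η o ∂P = 0 := by
  have hζ : MemLp (fun o : Obs d => o.2.1 - β * o.1 - inner ℝ γ o.2.2) 2 P :=
    (hP.2.1.sub (hP.1.const_mul β)).sub (hP.memLp_inner γ)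
  have hm : MeasurableSpace.comap (fun o : Obs d => (o.1, o.2.2)) inferInstance ≤
      (inferInstance : MeasurableSpace (Obs d)) :=
    Measurable.comap_le (by fun_prop)
  have hξ : StronglyMeasurable[MeasurableSpace.comap (fun o : Obs d => (o.1, o.2.2))
      inferInstance] (resX η) := by
    have h1 : Measurable fun xz : ℝ × EuclideanSpace ℝ (Fin d) => xz.1 - inner ℝ η xz.2 := by
      fun_prop
    exact (h1.comp (comap_measurable _)).stronglyMeasurable
  have hprod := hζ.integrable_mul (hP.memLp_resX η)
  -- The residual of `X` is a function of `(X, Z)`, so it leaves the conditional expectation.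
  have h2 := condExp_mul_of_stronglyMeasurable_right hξ hprod (hζ.integrable (by norm_num))
  calc _ = ∫ o, (P[(fun o : Obs d => o.2.1 - β * o.1 - inner ℝ γ o.2.2) * resX η |
        MeasurableSpace.comap (fun o : Obs d => (o.1, o.2.2)) inferInstance]) o ∂P :=
        (integral_condExp hm).symm
    _ = ∫ _, (0 : ℝ) ∂P := by
        refine integral_congr_ae ?_
        filter_upwards [h2, h] with o ho1 ho2
        rw [ho1, Pi.mul_apply, ho2]
        simp
    _ = 0 := integral_zero _ _

end Model

/-- In the linear model the covariance of the two residuals is `β σ_ξ²`. -/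
lemma integral_epsXi_eq {d : ℕ} {P : ProbabilityMeasure (Obs d)} {p : Params d}
    (hP : HasSecondMoments (P : Measure (Obs d)))
    (hlin : IsLinearModel (P : Measure (Obs d)) p.beta p.gamma)
    (hη : IsLeastSquaresProjection (P : Measure (Obs d)) (fun o => o.1) p.eta) :
    ∫ o, epsXi p o ∂(P : Measure (Obs d)) = p.beta * sigmaXiSq P p := by
  have hξ := hP.memLp_resX p.eta
  have hζ : MemLp (fun o : Obs d => o.2.1 - p.beta * o.1 - inner ℝ p.gamma o.2.2) 2
      (P : Measure (Obs d)) :=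
    (hP.2.1.sub (hP.1.const_mul p.beta)).sub (hP.memLp_inner p.gamma)
  -- This expands `ε = ζ + β ξ + (γ + β η - θ)ᵀZ`. The last term is linear in `Z`, hence orthogonal
  -- to `ξ` whatever `θ` is.
  have e : ∀ o : Obs d, epsXi p o =
      ((o.2.1 - p.beta * o.1 - inner ℝ p.gamma o.2.2) * resX p.eta o +
        p.beta * resX p.eta o ^ 2) +
      (o.1 - inner ℝ p.eta o.2.2) * inner ℝ (p.gamma + p.beta • p.eta - p.theta) o.2.2 := by
    intro o
    rw [inner_sub_left, inner_add_left, inner_smul_left]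
    simp only [conj_trivial, epsXi, resX, resY]
    ring
  simp_rw [e]
  have i1 : Integrable (fun o : Obs d =>
      (o.2.1 - p.beta * o.1 - inner ℝ p.gamma o.2.2) * resX p.eta o) (P : Measure (Obs d)) :=
    hζ.integrable_mul hξ
  have i2 : Integrable (fun o : Obs d => p.beta * resX p.eta o ^ 2) (P : Measure (Obs d)) :=
    hξ.integrable_sq.const_mul _
  have i3 : Integrable (fun o : Obs d => (o.1 - inner ℝ p.eta o.2.2) *
      inner ℝ (p.gamma + p.beta • p.eta - p.theta) o.2.2) (P : Measure (Obs d)) :=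
    hξ.integrable_mul (hP.memLp_inner _)
  have i12 : Integrable (fun o : Obs d =>
      (o.2.1 - p.beta * o.1 - inner ℝ p.gamma o.2.2) * resX p.eta o +
        p.beta * resX p.eta o ^ 2) (P : Measure (Obs d)) := i1.add i2
  rw [integral_add i12 i3, integral_add i1 i2, hlin.integral_mul_resX_eq_zero hP,
    hη.integral_mul_inner_eq_zero hP hP.1, integral_const_mul, sigmaXiSq]
  ring

/-- If `E(ξ²) = 0`, then `ξ`, and with it `εξ`, vanishes almost surely, leaving no variance. -/
lemma sigmaXiSq_pos {d : ℕ} {P : ProbabilityMeasure (Obs d)} {p : Params d}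
    (hP : HasSecondMoments (P : Measure (Obs d)))
    (hvar : 0 < Var[epsXi p; (P : Measure (Obs d))]) : 0 < sigmaXiSq P p := by
  refine lt_of_le_of_ne (integral_nonneg fun o => sq_nonneg _) fun h0 => hvar.ne' ?_
  rw [sigmaXiSq, eq_comm, integral_eq_zero_iff_of_nonneg (fun o => sq_nonneg _)
    (hP.memLp_resX _).integrable_sq] at h0
  have h1 : epsXi p =ᵐ[(P : Measure (Obs d))] 0 := by
    filter_upwards [h0] with o ho
    have : resX p.eta o = 0 := by simpa using ho
    simp [epsXi, this]
  rw [variance_congr h1]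
  exact variance_zero _

/-! ### Deterministic algebra of the studentised statistic. -/

section Sample

variable {n : ℕ}

/-- The empirical variance, with divisor `n`. -/
noncomputable def sampleVar (x : Fin n → ℝ) : ℝ :=
  (1 / (n : ℝ)) * ∑ i, x i ^ 2 - ((1 / (n : ℝ)) * ∑ i, x i) ^ 2

lemma sampleVar_eq_sub_sq (hn : 0 < n) (x : Fin n → ℝ) (m : ℝ) :
    sampleVar x = (1 / (n : ℝ)) * ∑ i, (x i - m) ^ 2 - ((1 / (n : ℝ)) * ∑ i, x i - m) ^ 2 := by
  have hn' : (n : ℝ) ≠ 0 := by exact_mod_cast hn.ne'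
  have e : ∑ i, (x i - m) ^ 2 = ∑ i, x i ^ 2 - 2 * m * ∑ i, x i + n * m ^ 2 := by
    simp_rw [sub_sq]
    rw [Finset.sum_add_distrib, Finset.sum_sub_distrib, Finset.mul_sum]
    simp only [Finset.sum_const, Finset.card_univ, Fintype.card_fin, nsmul_eq_mul]
    congr 2
    exact Finset.sum_congr rfl fun i _ => by ring
  rw [e, sampleVar]
  field_simp
  ring

lemma sampleVar_nonneg (hn : 0 < n) (x : Fin n → ℝ) : 0 ≤ sampleVar x := by
  rw [sampleVar_eq_sub_sq hn x ((1 / (n : ℝ)) * ∑ i, x i), sub_self]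
  have : 0 ≤ ∑ i, (x i - (1 / (n : ℝ)) * ∑ i, x i) ^ 2 := Finset.sum_nonneg fun i _ => sq_nonneg _
  have : 0 ≤ (1 / (n : ℝ)) * ∑ i, (x i - (1 / (n : ℝ)) * ∑ i, x i) ^ 2 := by positivity
  linarith

lemma sampleVar_le (x : Fin n → ℝ) : sampleVar x ≤ (1 / (n : ℝ)) * ∑ i, x i ^ 2 :=
  sub_le_self _ (sq_nonneg _)

/-- This exhibits the empirical standard deviation as a seminorm, so that the reverse triangle
inequality controls the effect of a perturbation. -/
lemma sqrt_sampleVar_eq_norm (hn : 0 < n) (x : Fin n → ℝ) :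
    √(sampleVar x) =
      (√(n : ℝ))⁻¹ * ‖WithLp.toLp 2 fun i => x i - (1 / (n : ℝ)) * ∑ j, x j‖ := by
  rw [sampleVar_eq_sub_sq hn x ((1 / (n : ℝ)) * ∑ i, x i), sub_self, EuclideanSpace.norm_eq]
  simp only [Real.norm_eq_abs, sq_abs]
  rw [← Real.sqrt_inv, ← Real.sqrt_mul (by positivity)]
  congr 1
  ring

lemma abs_sqrt_sampleVar_add_sub_le (hn : 0 < n) (x r : Fin n → ℝ) :
    |√(sampleVar fun i => x i + r i) - √(sampleVar x)| ≤ √((1 / (n : ℝ)) * ∑ i, r i ^ 2) := by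
  refine le_trans ?_ (Real.sqrt_le_sqrt (sampleVar_le r))
  rw [sqrt_sampleVar_eq_norm hn, sqrt_sampleVar_eq_norm hn, sqrt_sampleVar_eq_norm hn,
    ← mul_sub, abs_mul, abs_of_nonneg (by positivity : 0 ≤ (√(n : ℝ))⁻¹)]
  refine mul_le_mul_of_nonneg_left ((abs_norm_sub_norm_le _ _).trans_eq ?_) (by positivity)
  congr 1
  ext i
  simp only [PiLp.sub_apply, Finset.sum_add_distrib]
  ring

lemma abs_sqrt_sub_le {v σ : ℝ} (hv : 0 ≤ v) (hσ : 0 < σ) : |√v - σ| ≤ |v - σ ^ 2| / σ := by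
  have h : v - σ ^ 2 = (√v - σ) * (√v + σ) := by
    nlinarith [Real.sq_sqrt hv]
  have h2 : 0 ≤ √v := Real.sqrt_nonneg v
  rw [le_div_iff₀ hσ, h, abs_mul, abs_of_nonneg (by positivity : 0 ≤ √v + σ)]
  exact mul_le_mul_of_nonneg_left (by linarith) (abs_nonneg _)

/-- The studentised statistic depends on the scale only through its sign. -/
lemma studentised_const_mul (b : ℝ) (x : Fin n → ℝ) :
    studentised (fun i => b * x i) = SignType.sign b * studentised x := by
  have e1 : ∑ i, b * x i = b * ∑ i, x i := (Finset.mul_sum _ _ _).symm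
  have e2 : ∑ i, (b * x i) ^ 2 = b ^ 2 * ∑ i, x i ^ 2 := by
    simp_rw [mul_pow]
    exact (Finset.mul_sum _ _ _).symm
  have e3 : (1 / (n : ℝ)) * (b ^ 2 * ∑ i, x i ^ 2) - ((1 / (n : ℝ)) * (b * ∑ i, x i)) ^ 2 =
      b ^ 2 * ((1 / (n : ℝ)) * ∑ i, x i ^ 2 - ((1 / (n : ℝ)) * ∑ i, x i) ^ 2) := by ring
  rw [studentised, studentised, e1, e2, e3, Real.sqrt_mul (sq_nonneg b), Real.sqrt_sq_eq_abs]
  rcases lt_trichotomy b 0 with hb | hb | hb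
  · rw [sign_neg hb, abs_of_neg hb, neg_mul, div_neg, mul_left_comm, mul_div_mul_left _ _ hb.ne]
    simp
  -- At `b = 0` both sides vanish by the convention `0 / 0 = 0`.
  · simp [hb]
  · rw [sign_pos hb, abs_of_pos hb, mul_left_comm, mul_div_mul_left _ _ hb.ne']
    simp

lemma studentised_neg (x : Fin n → ℝ) : studentised (fun i => -x i) = -studentised x := by
  simpa using studentised_const_mul (-1) x

lemma sampleVar_neg (x : Fin n → ℝ) : sampleVar (fun i => -x i) = sampleVar x := by
  simp [sampleVar]

/-- The standardised sum of a sample with population mean `m` and standard deviation `σ`. -/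
noncomputable def standardisedSum (x : Fin n → ℝ) (m σ : ℝ) : ℝ :=
  (√(n : ℝ))⁻¹ * ∑ i, (x i - m) / σ

lemma standardisedSum_neg (x : Fin n → ℝ) (m σ : ℝ) :
    standardisedSum (fun i => -x i) (-m) σ = -standardisedSum x m σ := by
  unfold standardisedSum
  rw [← mul_neg, ← Finset.sum_neg_distrib]
  congr 1
  exact Finset.sum_congr rfl fun i _ => by ring

/-- Clearing the positive random denominator puts all the randomness of the studentisation into a
small shift of the threshold; the drift `√n m / σ` appears exactly. -/
lemma lt_studentised_iff (hn : 0 < n) {x r : Fin n → ℝ} {m σ : ℝ} (hσ : 0 < σ)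
    (hs : 0 < √(sampleVar fun i => x i + r i)) (z : ℝ) :
    z < studentised (fun i => x i + r i) ↔
      z - √(n : ℝ) * m / σ + (z * (√(sampleVar fun i => x i + r i) - σ) -
        (1 / √(n : ℝ)) * ∑ i, r i) / σ < standardisedSum x m σ := by
  have hn' : (0 : ℝ) < n := by exact_mod_cast hn
  have hsn : 0 < √(n : ℝ) := Real.sqrt_pos.2 hn'
  have hnum : (1 / √(n : ℝ)) * ∑ i, (x i + r i) = σ * standardisedSum x m σ + √(n : ℝ) * m +
      (1 / √(n : ℝ)) * ∑ i, r i := by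
    unfold standardisedSum
    rw [← Finset.sum_div, Finset.sum_sub_distrib, Finset.sum_add_distrib]
    simp only [Finset.sum_const, Finset.card_univ, Fintype.card_fin, nsmul_eq_mul]
    have := Real.mul_self_sqrt hn'.le
    field_simp
    rw [Real.sq_sqrt hn'.le]
    ring
  change z < ((1 / √(n : ℝ)) * ∑ i, (x i + r i)) / √(sampleVar fun i => x i + r i) ↔ _
  rw [lt_div_iff₀ hs, hnum]
  have e : z - √(n : ℝ) * m / σ + (z * (√(sampleVar fun i => x i + r i) - σ) -
        (1 / √(n : ℝ)) * ∑ i, r i) / σ =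
      (z * √(sampleVar fun i => x i + r i) - √(n : ℝ) * m - (1 / √(n : ℝ)) * ∑ i, r i) / σ := by
    field_simp
    ring
  rw [e, div_lt_iff₀ hσ]
  constructor <;> intro h <;> linarith

/-- The studentised statistic of a perturbed sample exceeds a level essentially when the
standardised sum exceeds the shifted level. -/
lemma studentised_sandwich (hn : 0 < n) {x r : Fin n → ℝ} {m σ κ ρ : ℝ} (hσ : 0 < σ)
    (hκσ : κ < σ) (hκ : |√(sampleVar fun i => x i + r i) - σ| ≤ κ)
    (hρ : |(1 / √(n : ℝ)) * ∑ i, r i| ≤ ρ) (z : ℝ) :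
    (z - √(n : ℝ) * m / σ + (|z| * κ + ρ) / σ < standardisedSum x m σ →
      z < studentised fun i => x i + r i) ∧
    (z < studentised (fun i => x i + r i) →
      z - √(n : ℝ) * m / σ - (|z| * κ + ρ) / σ < standardisedSum x m σ) := by
  have hs : 0 < √(sampleVar fun i => x i + r i) := by
    have := (abs_le.1 hκ).1
    linarith
  have hz : |z * (√(sampleVar fun i => x i + r i) - σ) - (1 / √(n : ℝ)) * ∑ i, r i| ≤
      |z| * κ + ρ := by
    refine (abs_sub _ _).trans (add_le_add ?_ hρ)
    rw [abs_mul]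
    exact mul_le_mul_of_nonneg_left hκ (abs_nonneg z)
  have hz' : |(z * (√(sampleVar fun i => x i + r i) - σ) - (1 / √(n : ℝ)) * ∑ i, r i) / σ| ≤
      (|z| * κ + ρ) / σ := by
    rw [abs_div, abs_of_pos hσ]
    exact div_le_div_of_nonneg_right hz hσ.le
  rw [abs_le] at hz'
  rw [lt_studentised_iff hn (m := m) hσ hs]
  constructor <;> intro h <;> linarith [hz'.1, hz'.2]

/-- The previous sandwich applied to `-x`, `-r`, `-m`: the empirical variance is even, and the
statistic and the standardised sum are odd. -/
lemma studentised_sandwich_neg (hn : 0 < n) {x r : Fin n → ℝ} {m σ κ ρ : ℝ} (hσ : 0 < σ)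
    (hκσ : κ < σ) (hκ : |√(sampleVar fun i => x i + r i) - σ| ≤ κ)
    (hρ : |(1 / √(n : ℝ)) * ∑ i, r i| ≤ ρ) (z : ℝ) :
    (standardisedSum x m σ < -(z + √(n : ℝ) * m / σ + (|z| * κ + ρ) / σ) →
      z < -studentised fun i => x i + r i) ∧
    (z < -studentised (fun i => x i + r i) →
      standardisedSum x m σ < -(z + √(n : ℝ) * m / σ - (|z| * κ + ρ) / σ)) := by
  have h := studentised_sandwich hn (x := fun i => -x i) (r := fun i => -r i) (m := -m)
    (ρ := ρ) hσ hκσ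
    (by
      simp_rw [← neg_add]
      rwa [sampleVar_neg (fun i => x i + r i)])
    (by rwa [Finset.sum_neg_distrib, mul_neg, abs_neg]) z
  simp_rw [← neg_add] at h
  rw [studentised_neg (fun i => x i + r i), standardisedSum_neg] at h
  have e : z - √(n : ℝ) * -m / σ = z + √(n : ℝ) * m / σ := by ring
  rw [e] at h
  exact ⟨fun h1 => h.1 (by linarith), fun h1 => by linarith [h.2 h1]⟩

end Sample

/-! ### The effect of estimating the projection coefficients. -/

section Perturbation

variable {d n : ℕ}

/-- The error made in the product of residuals when the coefficients are perturbed by `w` and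
`u`. -/
noncomputable def residualError (p : Params d) (w u : EuclideanSpace ℝ (Fin d)) (o : Obs d) : ℝ :=
  inner ℝ u o.2.2 * inner ℝ w o.2.2 - resX p.eta o * inner ℝ u o.2.2 -
    resY p.theta o * inner ℝ w o.2.2

lemma resY_mul_resX_eq (p : Params d) (η θ : EuclideanSpace ℝ (Fin d)) (o : Obs d) :
    resY θ o * resX η o = epsXi p o + residualError p (η - p.eta) (θ - p.theta) o := by
  simp only [epsXi, residualError, resX, resY, inner_sub_left]
  ring

lemma inner_gram (D : Fin n → Obs d) (u w : EuclideanSpace ℝ (Fin d)) :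
    inner ℝ u (Matrix.toEuclideanCLM (n := Fin d) (𝕜 := ℝ)
      ((1 / (n : ℝ)) • ∑ i, Matrix.vecMulVec (D i).2.2.ofLp (D i).2.2.ofLp) w) =
      (1 / (n : ℝ)) * ∑ i, inner ℝ u (D i).2.2 * inner ℝ w (D i).2.2 := by
  rw [map_smul, map_sum, smul_apply, sum_apply,
    inner_smul_right, inner_sum]
  congr 1
  refine Finset.sum_congr rfl fun i _ => ?_
  have h : Matrix.toEuclideanCLM (n := Fin d) (𝕜 := ℝ)
      (Matrix.vecMulVec (D i).2.2.ofLp (D i).2.2.ofLp) w =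
      (inner ℝ w (D i).2.2 : ℝ) • (D i).2.2 := by
    ext j
    simp [Matrix.vecMulVec_mulVec, PiLp.inner_apply, dotProduct, mul_comm]
  rw [h, inner_smul_right, mul_comm]

lemma abs_inner_gram_le (D : Fin n → Obs d) (u w : EuclideanSpace ℝ (Fin d)) :
    |(1 / (n : ℝ)) * ∑ i, inner ℝ u (D i).2.2 * inner ℝ w (D i).2.2| ≤
      ‖w‖ * ‖u‖ * gramOpNorm D := by
  rw [← inner_gram]
  refine (abs_real_inner_le_norm _ _).trans ?_
  rw [gramOpNorm, mul_comm ‖w‖, mul_assoc, mul_comm ‖w‖]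
  exact mul_le_mul_of_nonneg_left (ContinuousLinearMap.le_opNorm _ _) (norm_nonneg _)

lemma abs_mean_mul_inner_le (D : Fin n → Obs d) (f : Obs d → ℝ) (u : EuclideanSpace ℝ (Fin d)) :
    |(1 / (n : ℝ)) * ∑ i, f (D i) * inner ℝ u (D i).2.2| ≤
      ‖u‖ * ‖(1 / (n : ℝ)) • ∑ i, f (D i) • (D i).2.2‖ := by
  have e : (1 / (n : ℝ)) * ∑ i, f (D i) * inner ℝ u (D i).2.2 =
      inner ℝ u ((1 / (n : ℝ)) • ∑ i, f (D i) • (D i).2.2) := by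
    rw [inner_smul_right, inner_sum]
    simp_rw [inner_smul_right]
  rw [e]
  exact abs_real_inner_le_norm _ _

/-- The cross terms are inner products of a coefficient error with an empirical covariance vector,
bounded by Cauchy–Schwarz; the product of both errors is a bilinear form in the Gram matrix. The
three summands are the first three rate conditions. -/
lemma abs_sum_residualError_le (hn : 0 < n) (p : Params d) (w u : EuclideanSpace ℝ (Fin d))
    (D : Fin n → Obs d) :
    |(1 / √(n : ℝ)) * ∑ i, residualError p w u (D i)| ≤
      √(n : ℝ) * ‖u‖ * ‖(1 / (n : ℝ)) • ∑ i, resX p.eta (D i) • (D i).2.2‖ +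
      √(n : ℝ) * ‖w‖ * ‖(1 / (n : ℝ)) • ∑ i, resY p.theta (D i) • (D i).2.2‖ +
      √(n : ℝ) * ‖w‖ * ‖u‖ * gramOpNorm D := by
  have hn' : (0 : ℝ) < n := by exact_mod_cast hn
  have hsn : 0 < √(n : ℝ) := Real.sqrt_pos.2 hn'
  have e0 : 1 / √(n : ℝ) = √(n : ℝ) * (1 / (n : ℝ)) := by
    nth_rewrite 3 [← Real.mul_self_sqrt hn'.le]
    field_simp
  have e : (1 / √(n : ℝ)) * ∑ i, residualError p w u (D i) = √(n : ℝ) *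
      ((1 / (n : ℝ)) * ∑ i, inner ℝ u (D i).2.2 * inner ℝ w (D i).2.2 -
        (1 / (n : ℝ)) * ∑ i, resX p.eta (D i) * inner ℝ u (D i).2.2 -
        (1 / (n : ℝ)) * ∑ i, resY p.theta (D i) * inner ℝ w (D i).2.2) := by
    simp only [residualError, Finset.sum_sub_distrib]
    rw [e0]
    ring
  have h1 := abs_le.1 (abs_inner_gram_le D u w)
  have h2 := abs_le.1 (abs_mean_mul_inner_le D (resX p.eta) u)
  have h3 := abs_le.1 (abs_mean_mul_inner_le D (resY p.theta) w)
  rw [e, abs_mul, abs_of_pos hsn, mul_assoc, mul_assoc, mul_assoc, mul_assoc, ← mul_add,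
    ← mul_add, ← mul_assoc ‖w‖ ‖u‖]
  refine mul_le_mul_of_nonneg_left ?_ hsn.le
  rw [abs_le]
  constructor <;> linarith

/-- Pointwise Cauchy–Schwarz on each of the three error terms; the factor `3` comes from squaring a
sum of three. The summands are the last three rate conditions. -/
lemma mean_residualError_sq_le (p : Params d) (w u : EuclideanSpace ℝ (Fin d))
    (D : Fin n → Obs d) :
    (1 / (n : ℝ)) * ∑ i, residualError p w u (D i) ^ 2 ≤
      3 * (‖u‖ ^ 2 * ((1 / (n : ℝ)) * ∑ i, resX p.eta (D i) ^ 2 * ‖(D i).2.2‖ ^ 2) +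
        ‖w‖ ^ 2 * ((1 / (n : ℝ)) * ∑ i, resY p.theta (D i) ^ 2 * ‖(D i).2.2‖ ^ 2) +
        ‖w‖ ^ 2 * ‖u‖ ^ 2 * ((1 / (n : ℝ)) * ∑ i, ‖(D i).2.2‖ ^ 4)) := by
  have hpt : ∀ o : Obs d, residualError p w u o ^ 2 ≤
      3 * (‖u‖ ^ 2 * (resX p.eta o ^ 2 * ‖o.2.2‖ ^ 2) +
        ‖w‖ ^ 2 * (resY p.theta o ^ 2 * ‖o.2.2‖ ^ 2) + ‖w‖ ^ 2 * ‖u‖ ^ 2 * ‖o.2.2‖ ^ 4) := by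
    intro o
    have hu : (inner ℝ u o.2.2 : ℝ) ^ 2 ≤ ‖u‖ ^ 2 * ‖o.2.2‖ ^ 2 := by
      rw [← mul_pow, ← sq_abs]
      exact pow_le_pow_left₀ (abs_nonneg _) (abs_real_inner_le_norm _ _) 2
    have hw : (inner ℝ w o.2.2 : ℝ) ^ 2 ≤ ‖w‖ ^ 2 * ‖o.2.2‖ ^ 2 := by
      rw [← mul_pow, ← sq_abs]
      exact pow_le_pow_left₀ (abs_nonneg _) (abs_real_inner_le_norm _ _) 2
    have h1 := mul_le_mul_of_nonneg_left hu (sq_nonneg (resX p.eta o))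
    have h2 := mul_le_mul_of_nonneg_left hw (sq_nonneg (resY p.theta o))
    have h3 := mul_le_mul hu hw (sq_nonneg _) (by positivity)
    have h4 : ∀ a b c : ℝ, (a - b - c) ^ 2 ≤ 3 * (b ^ 2 + c ^ 2 + a ^ 2) := fun a b c => by
      nlinarith [sq_nonneg (a + b), sq_nonneg (a + c), sq_nonneg (b - c)]
    refine (h4 _ _ _).trans ?_
    rw [mul_pow, mul_pow, mul_pow]
    linarith
  have hsum := Finset.sum_le_sum fun i (_ : i ∈ Finset.univ) => hpt (D i)
  rw [← Finset.mul_sum, Finset.sum_add_distrib, Finset.sum_add_distrib, ← Finset.mul_sum,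
    ← Finset.mul_sum, ← Finset.mul_sum] at hsum
  have := mul_le_mul_of_nonneg_left hsum (by positivity : 0 ≤ 1 / (n : ℝ))
  linarith

end Perturbation

/-! ### The lower bound for the asymptotic power. -/

section Psi

variable {d : ℕ} {P : ProbabilityMeasure (Obs d)} {p : Params d} {α : ℝ}

lemma psi_eq_of_beta_eq_zero (h0 : 0 < α) (h1 : α < 1) (hβ : p.beta = 0) (n₁ n₂ : ℕ) :
    psi P p α n₁ n₂ = α := by
  rw [psi, hβ]
  simp only [mul_zero, zero_div, neg_zero, zero_mul, add_zero, sub_zero]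
  rw [stdNormalCDF_zero, stdNormalCDF_quantile h0 h1]
  ring

lemma lt_psi_of_beta_ne_zero (h0 : 0 < α) (h1 : α < 1 / 2) (hβ : p.beta ≠ 0)
    (hσβ : 0 < p.sigmaBeta) (hξ : 0 < sigmaXiSq P p) (hεξ : 0 < sigmaEpsXi P p) {n₁ n₂ : ℕ}
    (hn₁ : 0 < n₁) (hn₂ : 0 < n₂) : α < psi P p α n₁ n₂ := by
  have hq := stdNormalCDF_quantile h0 (h1.trans (by norm_num))
  have hz : stdNormalQuantile α ≤ 0 := by
    rw [← strictMono_stdNormalCDF.le_iff_le, hq, stdNormalCDF_zero]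
    exact h1.le
  have hs₁ : 0 < √(n₁ : ℝ) := Real.sqrt_pos.2 (by exact_mod_cast hn₁)
  have hs₂ : 0 < √(n₂ : ℝ) := Real.sqrt_pos.2 (by exact_mod_cast hn₂)
  rw [psi]
  conv_lhs => rw [← hq]
  rcases hβ.lt_or_gt with hβ | hβ
  -- Changing the sign of `β` swaps the two summands of `ψ`, which reduces to the positive case.
  · have hβ' : 0 < -p.beta := neg_pos.2 hβ
    have h := lt_stdNormalCDF_mixture hz (b := √(n₂ : ℝ) * -p.beta / p.sigmaBeta)
      (k := √(n₁ : ℝ) * -p.beta * sigmaXiSq P p / sigmaEpsXi P p) (by positivity) (by positivity)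
    simp only [mul_neg, neg_mul, neg_div, neg_neg, sub_neg_eq_add, ← sub_eq_add_neg] at h
    rw [add_comm] at h
    exact h
  · exact lt_stdNormalCDF_mixture hz (by positivity) (by positivity)

end Psi

/-! ### Comparing probabilities of events with values of `Φ`. -/

section Comparison

variable {Ω : Type*} [MeasurableSpace Ω] {μ : Measure Ω} [IsProbabilityMeasure μ]
  {N : Ω → ℝ} {A B : Set Ω} {e₁ e₂ τ t : ℝ}

lemma abs_measureReal_sub_le_of_upper (hN : Measurable N) (hB : μ.real B ≤ e₁)
    (hclt : ∀ t, |μ.real {ω | N ω ≤ t} - stdNormalCDF t| ≤ e₂) (hτ : 0 ≤ τ)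
    (h : ∀ ω ∉ B, (t + τ < N ω → ω ∈ A) ∧ (ω ∈ A → t - τ < N ω)) :
    |μ.real A - stdNormalCDF (-t)| ≤ e₁ + e₂ + τ := by
  have hcompl : ∀ s, μ.real {ω | s < N ω} = 1 - μ.real {ω | N ω ≤ s} := by
    intro s
    rw [← probReal_compl_eq_one_sub (measurableSet_le hN measurable_const)]
    congr 1
    ext ω
    simp
  have h1 : A ⊆ B ∪ {ω | t - τ < N ω} := fun ω hω => by
    by_cases hωB : ω ∈ B
    · exact Or.inl hωB
    · exact Or.inr ((h ω hωB).2 hω)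
  have h2 : {ω | t + τ < N ω} ⊆ B ∪ A := fun ω hω => by
    by_cases hωB : ω ∈ B
    · exact Or.inl hωB
    · exact Or.inr ((h ω hωB).1 hω)
  have m1 := (measureReal_mono h1 (measure_ne_top μ _)).trans (measureReal_union_le _ _)
  have m2 := (measureReal_mono h2 (measure_ne_top μ _)).trans (measureReal_union_le _ _)
  rw [hcompl] at m1 m2
  have c1 := abs_le.1 (hclt (t - τ))
  have c2 := abs_le.1 (hclt (t + τ))
  have l1 := stdNormalCDF_le_add (show t - τ ≤ t by linarith)
  have l2 := stdNormalCDF_le_add (show t ≤ t + τ by linarith)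
  rw [stdNormalCDF_neg, abs_le]
  constructor <;> linarith [c1.1, c1.2, c2.1, c2.2]

/-- The hypothesis concerns strict inequalities while `hclt` concerns `≤`. Lowering the threshold to
`t - 2 * τ` makes the inequality strict, which is the source of the factor `2` and of the
requirement `0 < τ`. -/
lemma abs_measureReal_sub_le_of_lower (hB : μ.real B ≤ e₁)
    (hclt : ∀ t, |μ.real {ω | N ω ≤ t} - stdNormalCDF t| ≤ e₂) (hτ : 0 < τ)
    (h : ∀ ω ∉ B, (N ω < t - τ → ω ∈ A) ∧ (ω ∈ A → N ω < t + τ)) :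
    |μ.real A - stdNormalCDF t| ≤ e₁ + e₂ + 2 * τ := by
  have h1 : A ⊆ B ∪ {ω | N ω ≤ t + τ} := fun ω hω => by
    by_cases hωB : ω ∈ B
    · exact Or.inl hωB
    · exact Or.inr ((h ω hωB).2 hω).le
  have h2 : {ω | N ω ≤ t - 2 * τ} ⊆ B ∪ A := fun ω hω => by
    by_cases hωB : ω ∈ B
    · exact Or.inl hωB
    · exact Or.inr ((h ω hωB).1 (lt_of_le_of_lt hω (by linarith)))
  have m1 := (measureReal_mono h1 (measure_ne_top μ _)).trans (measureReal_union_le _ _)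
  have m2 := (measureReal_mono h2 (measure_ne_top μ _)).trans (measureReal_union_le _ _)
  have c1 := abs_le.1 (hclt (t + τ))
  have c2 := abs_le.1 (hclt (t - 2 * τ))
  have l1 := stdNormalCDF_le_add (show t - 2 * τ ≤ t by linarith)
  have l2 := stdNormalCDF_le_add (show t ≤ t + τ by linarith)
  rw [abs_le]
  constructor <;> linarith [c1.1, c1.2, c2.1, c2.2]

/-- The sign of an approximately normal estimator. -/
lemma sign_probabilities {X : Ω → ℝ} (hX : Measurable X) {s β ε : ℝ} (hs : 0 < s) (hε : 0 < ε)
    (hclt : ∀ t, |μ.real {ω | s * (X ω - β) ≤ t} - stdNormalCDF t| ≤ ε) :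
    |μ.real {ω | 0 < X ω} - stdNormalCDF (s * β)| ≤ ε ∧
      |μ.real {ω | X ω < 0} - stdNormalCDF (-(s * β))| ≤ 2 * ε ∧
      μ.real {ω | X ω = 0} ≤ 3 * ε := by
  have hle : {ω | s * (X ω - β) ≤ -(s * β)} = {ω | X ω ≤ 0} := by
    ext ω
    simp only [Set.mem_ofPred_eq]
    rw [mul_sub, sub_le_iff_le_add, neg_add_cancel]
    exact ⟨fun h => nonpos_of_mul_nonpos_right h hs,
      fun h => mul_nonpos_of_nonneg_of_nonpos hs.le h⟩
  have h0 := hclt (-(s * β))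
  rw [hle] at h0
  -- The extra `ε` forces `X < 0` strictly. It costs `ε` by the Lipschitz bound, hence the `2 * ε`;
  -- comparison with `X ≤ 0` leaves `3 * ε` for the atom at zero.
  have hlt : {ω | s * (X ω - β) ≤ -(s * β) - ε} ⊆ {ω | X ω < 0} := by
    intro ω hω
    simp only [Set.mem_ofPred_eq] at hω ⊢
    by_contra! hcon
    have := mul_nonneg hs.le hcon
    linarith
  have h1 := abs_le.1 (hclt (-(s * β) - ε))
  have m1 := measureReal_mono hlt (measure_ne_top μ _)
  have m2 : μ.real {ω | X ω < 0} ≤ μ.real {ω | X ω ≤ 0} :=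
    measureReal_mono fun ω hω => show X ω ≤ 0 from le_of_lt (show X ω < 0 from hω)
  have l1 := stdNormalCDF_le_add (show -(s * β) - ε ≤ -(s * β) by linarith)
  have hpos : μ.real {ω | 0 < X ω} = 1 - μ.real {ω | X ω ≤ 0} := by
    rw [← probReal_compl_eq_one_sub (measurableSet_le hX measurable_const)]
    congr 1
    ext ω
    simp
  have hzero : μ.real {ω | X ω ≤ 0} = μ.real {ω | X ω < 0} + μ.real {ω | X ω = 0} := by
    rw [← measureReal_union _ (measurableSet_eq_fun hX measurable_const)]
    · congr 1
      ext ω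
      simp [le_iff_lt_or_eq]
    · rw [Set.disjoint_left]
      intro ω hω hω'
      simp only [Set.mem_ofPred_eq] at hω hω'
      linarith
  have hneg := stdNormalCDF_neg (s * β)
  rw [abs_le] at h0
  refine ⟨?_, ?_, ?_⟩
  · rw [hpos, abs_le]
    constructor <;> linarith [h0.1, h0.2]
  · rw [abs_le]
    constructor <;> linarith [h0.1, h0.2, h1.1, h1.2]
  · linarith [h0.1, h0.2, h1.1, h1.2]

/-- The upper tail of a statistic multiplied by an independent sign. -/
lemma abs_measureReal_prod_sign_sub_le {Ω' : Type*} [MeasurableSpace Ω'] {μ' : Measure Ω'}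
    [IsProbabilityMeasure μ'] {S : Ω → ℝ} (hS : Measurable S) {X : Ω' → ℝ} (hX : Measurable X)
    (z : ℝ) :
    |(μ.prod μ').real {ω | z < SignType.sign (X ω.2) * S ω.1} -
      (μ'.real {ω | 0 < X ω} * μ.real {ω | z < S ω} +
        μ'.real {ω | X ω < 0} * μ.real {ω | z < -S ω})| ≤ μ'.real {ω | X ω = 0} := by
  have e1 : μ'.real {ω | 0 < X ω} * μ.real {ω | z < S ω} =
      (μ.prod μ').real ({ω | z < S ω} ×ˢ {ω | 0 < X ω}) := by
    rw [measureReal_prod_prod, mul_comm]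
  have e2 : μ'.real {ω | X ω < 0} * μ.real {ω | z < -S ω} =
      (μ.prod μ').real ({ω | z < -S ω} ×ˢ {ω | X ω < 0}) := by
    rw [measureReal_prod_prod, mul_comm]
  have e3 : μ'.real {ω | X ω = 0} =
      (μ.prod μ').real (Set.univ ×ˢ {ω | X ω = 0}) := by
    rw [measureReal_prod_prod]
    simp
  have hmeas : MeasurableSet ({ω | z < -S ω} ×ˢ {ω | X ω < 0}) :=
    (measurableSet_lt measurable_const hS.neg).prod (measurableSet_lt hX measurable_const)
  have hdisj : Disjoint ({ω | z < S ω} ×ˢ {ω | 0 < X ω}) ({ω | z < -S ω} ×ˢ {ω | X ω < 0}) := by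
    rw [Set.disjoint_left]
    rintro ω ⟨-, h1⟩ ⟨-, h2⟩
    exact lt_asymm (show 0 < X ω.2 from h1) h2
  rw [e1, e2, e3, ← measureReal_union hdisj hmeas]
  have hsub1 : ({ω | z < S ω} ×ˢ {ω | 0 < X ω}) ∪ ({ω | z < -S ω} ×ˢ {ω | X ω < 0}) ⊆
      {ω : Ω × Ω' | z < SignType.sign (X ω.2) * S ω.1} := by
    rintro ω (⟨h1, h2⟩ | ⟨h1, h2⟩)
    · have h2' : 0 < X ω.2 := h2
      simpa [sign_pos h2'] using h1
    · have h2' : X ω.2 < 0 := h2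
      simpa [sign_neg h2'] using h1
  have hsub2 : {ω : Ω × Ω' | z < SignType.sign (X ω.2) * S ω.1} ⊆
      (({ω | z < S ω} ×ˢ {ω | 0 < X ω}) ∪ ({ω | z < -S ω} ×ˢ {ω | X ω < 0})) ∪
        Set.univ ×ˢ {ω | X ω = 0} := by
    intro ω hω
    rcases lt_trichotomy (X ω.2) 0 with h | h | h
    · refine Or.inl (Or.inr ⟨?_, h⟩)
      simpa [sign_neg h] using hω
    · exact Or.inr ⟨Set.mem_univ _, h⟩
    · refine Or.inl (Or.inl ⟨?_, h⟩)
      simpa [sign_pos h] using hω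
  have m1 := measureReal_mono hsub1 (measure_ne_top (μ.prod μ') _)
  have m2 := (measureReal_mono hsub2 (measure_ne_top (μ.prod μ') _)).trans
    (measureReal_union_le _ _)
  rw [abs_le]
  constructor <;> linarith

lemma abs_mul_sub_mul_le {a b a' b' x y : ℝ} (h1 : |a - a'| ≤ x) (h2 : |b - b'| ≤ y)
    (ha : |a| ≤ 1) (hb : |b'| ≤ 1) : |a * b - a' * b'| ≤ x + y := by
  have e : a * b - a' * b' = a * (b - b') + (a - a') * b' := by ring
  rw [e]
  refine (abs_add_le _ _).trans ?_
  rw [abs_mul, abs_mul]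
  have := mul_le_mul ha h2 (abs_nonneg _) zero_le_one
  have := mul_le_mul h1 hb (abs_nonneg _) ((abs_nonneg _).trans h1)
  linarith

end Comparison

/-! ### Uniform limits over the family and marginals of the sample law. -/

section Uniform

lemma tendsto_biSup_zero_iff {ι : Type*} {l : Filter ι} {A : ι → Type*} {S : ∀ i, Set (A i)}
    {f : ∀ i, A i → ℝ≥0∞} :
    Tendsto (fun i => ⨆ a ∈ S i, f i a) l (𝓝 0) ↔
      ∀ ε : ℝ, 0 < ε → ∀ᶠ i in l, ∀ a ∈ S i, f i a ≤ ENNReal.ofReal ε := by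
  rw [ENNReal.tendsto_nhds_zero]
  constructor
  · intro h ε hε
    filter_upwards [h _ (ENNReal.ofReal_pos.2 hε)] with i hi a ha
    exact (le_iSup₂ (f := fun a (_ : a ∈ S i) => f i a) a ha).trans hi
  · intro h ε hε
    rcases eq_or_ne ε ⊤ with rfl | hε'
    · simp
    filter_upwards [h ε.toReal (ENNReal.toReal_pos hε.ne' hε')] with i hi
    rw [ENNReal.ofReal_toReal hε'] at hi
    exact iSup₂_le hi

lemma tendsto_fst_minAtTop : Tendsto Prod.fst minAtTop atTop :=
  tendsto_atTop_mono (fun n : ℕ × ℕ => min_le_left n.1 n.2) tendsto_comap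

lemma tendsto_snd_minAtTop : Tendsto Prod.snd minAtTop atTop :=
  tendsto_atTop_mono (fun n : ℕ × ℕ => min_le_right n.1 n.2) tendsto_comap

variable {U₁ U₂ : Type*} [MeasurableSpace U₁] [MeasurableSpace U₂]
  {ν₁ : Measure U₁} [IsProbabilityMeasure ν₁] {ν₂ : Measure U₂} [IsProbabilityMeasure ν₂]

instance isProbabilityMeasure_trainLaw {d : ℕ} (P : ProbabilityMeasure (Obs d)) (m : ℕ) :
    IsProbabilityMeasure (trainLaw ν₁ P m) := by
  unfold trainLaw
  infer_instance

instance isProbabilityMeasure_sampleLaw {d : ℕ} (P : ProbabilityMeasure (Obs d)) (n₁ n₂ : ℕ) :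
    IsProbabilityMeasure (sampleLaw ν₁ ν₂ P n₁ n₂) := by
  unfold sampleLaw
  infer_instance

lemma measureReal_prod_fst {Ω Ω' : Type*} [MeasurableSpace Ω] [MeasurableSpace Ω']
    {μ : Measure Ω} [SFinite μ] {μ' : Measure Ω'} [IsProbabilityMeasure μ'] (p : Ω → Prop) :
    (μ.prod μ').real {ω | p ω.1} = μ.real {ω | p ω} := by
  have : {ω : Ω × Ω' | p ω.1} = {ω | p ω} ×ˢ Set.univ := by
    ext
    simp
  rw [this, measureReal_prod_prod]
  simp

lemma measureReal_prod_snd {Ω Ω' : Type*} [MeasurableSpace Ω] [MeasurableSpace Ω']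
    {μ : Measure Ω} [IsProbabilityMeasure μ] {μ' : Measure Ω'} [SFinite μ'] (p : Ω' → Prop) :
    (μ.prod μ').real {ω | p ω.2} = μ'.real {ω | p ω} := by
  have : {ω : Ω × Ω' | p ω.2} = Set.univ ×ˢ {ω | p ω} := by
    ext
    simp
  rw [this, measureReal_prod_prod]
  simp

/-- A sequence that is `o_P(1)` and depends on the first data set only. -/
lemma IsLittleOP.eventually_measureReal_le {d : ℕ → ℕ → ℕ}
    {Fam : ∀ n₁ n₂ : ℕ, Set (ProbabilityMeasure (Obs (d n₁ n₂)))}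
    {W : ∀ n₁ n₂ : ℕ, ProbabilityMeasure (Obs (d n₁ n₂)) → TrainSpace U₁ (d n₁ n₂) n₁ → ℝ}
    (hW : IsLittleOP ν₁ ν₂ d Fam fun n₁ n₂ P ω => W n₁ n₂ P ω.1) {h ε : ℝ} (hh : 0 < h)
    (hε : 0 < ε) :
    ∀ᶠ n : ℕ × ℕ in minAtTop, ∀ P ∈ Fam n.1 n.2,
      (trainLaw ν₁ P n.1).real {w | h < W n.1 n.2 P w} ≤ ε := by
  have h1 := tendsto_biSup_zero_iff.1 (hW h hh) ε hε
  filter_upwards [h1] with n hn P hP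
  have h2 := ENNReal.toReal_le_of_le_ofReal hε.le (hn P hP)
  rw [← measureReal_def, sampleLaw,
    measureReal_prod_fst (fun w : TrainSpace U₁ (d n.1 n.2) n.1 => h < |W n.1 n.2 P w|)] at h2
  refine le_trans (measureReal_mono ?_ (measure_ne_top _ _)) h2
  exact fun w hw => show h < |W n.1 n.2 P w| from
    lt_of_lt_of_le (show h < W n.1 n.2 P w from hw) (le_abs_self _)

end Uniform

/-- The moment condition is given as a lower Lebesgue integral, so its finiteness carries
integrability with it. -/
lemma integrable_and_integral_le_of_lintegral {Ω : Type*} [MeasurableSpace Ω] {μ : Measure Ω}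
    {f : Ω → ℝ} (hf : Measurable f) (hf0 : ∀ x, 0 ≤ f x) {C : ℝ} (hC : 0 ≤ C)
    (h : ∫⁻ x, ENNReal.ofReal (f x) ∂μ ≤ ENNReal.ofReal C) :
    Integrable f μ ∧ ∫ x, f x ∂μ ≤ C := by
  refine ⟨⟨hf.aestronglyMeasurable, ?_⟩, ?_⟩
  · rw [hasFiniteIntegral_iff_ofReal (ae_of_all _ hf0)]
    exact h.trans_lt ENNReal.ofReal_lt_top
  · rw [integral_eq_lintegral_of_nonneg_ae (ae_of_all _ hf0) hf.aestronglyMeasurable]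
    exact ENNReal.toReal_le_of_le_ofReal hC h

/-! ### Reduction to a statistic of the first data set. -/

section Statistic

variable {U₁ U₂ : Type*} [MeasurableSpace U₁] [MeasurableSpace U₂]

/-- The studentised statistic of the products of the estimated residuals. -/
noncomputable def residualStatistic (est : Estimators U₁ U₂) (d n : ℕ) (w : TrainSpace U₁ d n) : ℝ :=
  studentised fun i : Fin n =>
    resY (est.theta d n w) (w.1 i) * resX (est.eta d n w) (w.1 i)

lemma measurable_residualStatistic (est : Estimators U₁ U₂) (d n : ℕ) :
    Measurable (residualStatistic est d n) := by
  have h1 := est.measurable_eta d n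
  have h2 := est.measurable_theta d n
  unfold residualStatistic studentised resX resY
  fun_prop

lemma pcmStatistic_eq (est : Estimators U₁ U₂) (d n₁ n₂ : ℕ) (ω : SampleSpace U₁ U₂ d n₁ n₂) :
    pcmStatistic est d n₁ n₂ ω =
      SignType.sign (est.beta d n₂ ω.2) * residualStatistic est d n₁ ω.1 :=
  studentised_const_mul _ _

/-- Deterministic control of the statistic in terms of the quantities in the assumptions. -/
lemma residualStatistic_sandwich (est : Estimators U₁ U₂) {d n : ℕ} (hn : 0 < n) (p : Params d)
    {m σ s h τ z : ℝ} (hs : 0 < s) (hsσ : s ≤ σ) (hh : 0 < h)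
    (hκ : √(9 * h) + (h + h ^ 2) / s < s)
    (hτ : (|z| * (√(9 * h) + (h + h ^ 2) / s) + 3 * h) / s ≤ τ) (w : TrainSpace U₁ d n)
    (h1 : √(n : ℝ) * ‖est.theta d n w - p.theta‖ *
      ‖(1 / (n : ℝ)) • ∑ i, resX p.eta (w.1 i) • (w.1 i).2.2‖ ≤ h)
    (h2 : √(n : ℝ) * ‖est.eta d n w - p.eta‖ *
      ‖(1 / (n : ℝ)) • ∑ i, resY p.theta (w.1 i) • (w.1 i).2.2‖ ≤ h)
    (h3 : √(n : ℝ) * ‖est.eta d n w - p.eta‖ * ‖est.theta d n w - p.theta‖ *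
      gramOpNorm w.1 ≤ h)
    (h4 : ‖est.theta d n w - p.theta‖ ^ 2 *
      ((1 / (n : ℝ)) * ∑ i, resX p.eta (w.1 i) ^ 2 * ‖(w.1 i).2.2‖ ^ 2) ≤ h)
    (h5 : ‖est.eta d n w - p.eta‖ ^ 2 *
      ((1 / (n : ℝ)) * ∑ i, resY p.theta (w.1 i) ^ 2 * ‖(w.1 i).2.2‖ ^ 2) ≤ h)
    (h6 : ‖est.eta d n w - p.eta‖ ^ 2 * ‖est.theta d n w - p.theta‖ ^ 2 *
      ((1 / (n : ℝ)) * ∑ i, ‖(w.1 i).2.2‖ ^ 4) ≤ h)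
    (h7 : |(1 / (n : ℝ)) * ∑ i, epsXi p (w.1 i) - m| ≤ h)
    (h8 : |(1 / (n : ℝ)) * ∑ i, (epsXi p (w.1 i) - m) ^ 2 - σ ^ 2| ≤ h) :
    ((z - √(n : ℝ) * m / σ + τ < standardisedSum (fun i => epsXi p (w.1 i)) m σ →
        z < residualStatistic est d n w) ∧
      (z < residualStatistic est d n w →
        z - √(n : ℝ) * m / σ - τ < standardisedSum (fun i => epsXi p (w.1 i)) m σ)) ∧
    ((standardisedSum (fun i => epsXi p (w.1 i)) m σ < -(z + √(n : ℝ) * m / σ) - τ →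
        z < -residualStatistic est d n w) ∧
      (z < -residualStatistic est d n w →
        standardisedSum (fun i => epsXi p (w.1 i)) m σ < -(z + √(n : ℝ) * m / σ) + τ)) := by
  have hσ : 0 < σ := hs.trans_le hsσ
  set u := est.theta d n w - p.theta with hu
  set v := est.eta d n w - p.eta with hv
  -- The first term is the effect of the estimated coefficients on the denominator, the second that
  -- of sampling. Since `κ < s ≤ σ`, the denominator stays positive on this event.
  set κ := √(9 * h) + (h + h ^ 2) / s with hκdef
  have hκ0 : 0 ≤ κ := by positivity
  have hS : residualStatistic est d n w =
      studentised fun i => epsXi p (w.1 i) + residualError p v u (w.1 i) := by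
    unfold residualStatistic
    congr 1
    ext i
    exact resY_mul_resX_eq p _ _ _
  have hρ : |(1 / √(n : ℝ)) * ∑ i, residualError p v u (w.1 i)| ≤ 3 * h :=
    (abs_sum_residualError_le hn p v u w.1).trans (by linarith)
  have hq : (1 / (n : ℝ)) * ∑ i, residualError p v u (w.1 i) ^ 2 ≤ 9 * h :=
    (mean_residualError_sq_le p v u w.1).trans (by linarith)
  have hd1 : |√(sampleVar fun i => epsXi p (w.1 i) + residualError p v u (w.1 i)) -
      √(sampleVar fun i => epsXi p (w.1 i))| ≤ √(9 * h) :=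
    (abs_sqrt_sampleVar_add_sub_le hn _ _).trans (Real.sqrt_le_sqrt hq)
  have hd2 : |√(sampleVar fun i => epsXi p (w.1 i)) - σ| ≤ (h + h ^ 2) / s := by
    refine (abs_sqrt_sub_le (sampleVar_nonneg hn _) hσ).trans ?_
    have hsq : ((1 / (n : ℝ)) * ∑ i, epsXi p (w.1 i) - m) ^ 2 ≤ h ^ 2 := by
      rw [← sq_abs]
      exact pow_le_pow_left₀ (abs_nonneg _) h7 2
    have hnum : |sampleVar (fun i => epsXi p (w.1 i)) - σ ^ 2| ≤ h + h ^ 2 := by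
      rw [sampleVar_eq_sub_sq hn _ m, sub_right_comm]
      refine (abs_sub _ _).trans (add_le_add h8 ?_)
      rwa [abs_of_nonneg (sq_nonneg _)]
    exact div_le_div₀ (by positivity) hnum hs hsσ
  have hd : |√(sampleVar fun i => epsXi p (w.1 i) + residualError p v u (w.1 i)) - σ| ≤ κ :=
    (abs_sub_le _ _ _).trans (add_le_add hd1 hd2)
  have hτ' : (|z| * κ + 3 * h) / σ ≤ τ := by
    refine le_trans ?_ hτ
    gcongr
  have A := studentised_sandwich hn (m := m) hσ (hκ.trans_le hsσ) hd hρ z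
  have B := studentised_sandwich_neg hn (m := m) hσ (hκ.trans_le hsσ) hd hρ z
  rw [hS]
  exact ⟨⟨fun h => A.1 (by linarith), fun h => by linarith [A.2 h]⟩,
    ⟨fun h => B.1 (by linarith), fun h => by linarith [B.2 h]⟩⟩

end Statistic

/-! ### Assembling the uniform power approximation. -/

section Power

variable {U₁ U₂ : Type*} [MeasurableSpace U₁] [MeasurableSpace U₂]
  {ν₁ : Measure U₁} [IsProbabilityMeasure ν₁] {ν₂ : Measure U₂} [IsProbabilityMeasure ν₂]

/-- The rejection probability is close to `ψ` when the two tails of the residual statistic and the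
sign probabilities of `β̂` are close to their limits. -/
lemma abs_measureReal_pcmStatistic_sub_psi_le (est : Estimators U₁ U₂) {d n₁ n₂ : ℕ}
    {P : ProbabilityMeasure (Obs d)} {p : Params d} {α ε e : ℝ} (h0 : 0 < α) (h1 : α < 1)
    (hε : 0 < ε) (hn₂ : 0 < n₂) (hσβ : 0 < p.sigmaBeta)
    (hbeta : ∀ t : ℝ, |(sampleLaw ν₁ ν₂ P n₁ n₂).real
      {ω | √(n₂ : ℝ) * p.sigmaBeta⁻¹ * (est.beta d n₂ ω.2 - p.beta) ≤ t} - stdNormalCDF t| ≤ ε)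
    (hup : |(trainLaw ν₁ P n₁).real {w | stdNormalQuantile (1 - α) < residualStatistic est d n₁ w} -
      stdNormalCDF (-(stdNormalQuantile (1 - α) -
        √(n₁ : ℝ) * (p.beta * sigmaXiSq P p) / sigmaEpsXi P p))| ≤ e)
    (hlow : |(trainLaw ν₁ P n₁).real
        {w | stdNormalQuantile (1 - α) < -residualStatistic est d n₁ w} -
      stdNormalCDF (-(stdNormalQuantile (1 - α) +
        √(n₁ : ℝ) * (p.beta * sigmaXiSq P p) / sigmaEpsXi P p))| ≤ e) :
    |(sampleLaw ν₁ ν₂ P n₁ n₂).real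
        {ω | stdNormalQuantile (1 - α) < pcmStatistic est d n₁ n₂ ω} - psi P p α n₁ n₂| ≤
      6 * ε + 2 * e := by
  have hs : 0 < √(n₂ : ℝ) * p.sigmaBeta⁻¹ :=
    mul_pos (Real.sqrt_pos.2 (by exact_mod_cast hn₂)) (inv_pos.2 hσβ)
  have hbeta' : ∀ t : ℝ, |(trainLaw ν₂ P n₂).real
      {w | √(n₂ : ℝ) * p.sigmaBeta⁻¹ * (est.beta d n₂ w - p.beta) ≤ t} - stdNormalCDF t| ≤ ε := by
    intro t
    have := hbeta t
    rwa [sampleLaw, measureReal_prod_snd (fun w : TrainSpace U₂ d n₂ =>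
      √(n₂ : ℝ) * p.sigmaBeta⁻¹ * (est.beta d n₂ w - p.beta) ≤ t)] at this
  obtain ⟨b1, b2, b3⟩ := sign_probabilities (est.measurable_beta d n₂) hs hε hbeta'
  have hmain := abs_measureReal_prod_sign_sub_le (μ := trainLaw ν₁ P n₁) (μ' := trainLaw ν₂ P n₂)
    (measurable_residualStatistic est d n₁) (est.measurable_beta d n₂) (stdNormalQuantile (1 - α))
  simp_rw [← pcmStatistic_eq est d n₁ n₂] at hmain
  change |(sampleLaw ν₁ ν₂ P n₁ n₂).real _ - _| ≤ _ at hmain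
  have eb : √(n₂ : ℝ) * p.sigmaBeta⁻¹ * p.beta = √(n₂ : ℝ) * p.beta / p.sigmaBeta := by
    rw [div_eq_mul_inv]
    ring
  have ek1 : -(stdNormalQuantile (1 - α) -
        √(n₁ : ℝ) * (p.beta * sigmaXiSq P p) / sigmaEpsXi P p) =
      stdNormalQuantile α + √(n₁ : ℝ) * p.beta * sigmaXiSq P p / sigmaEpsXi P p := by
    rw [stdNormalQuantile_one_sub h0 h1]
    ring
  have ek2 : -(stdNormalQuantile (1 - α) +
        √(n₁ : ℝ) * (p.beta * sigmaXiSq P p) / sigmaEpsXi P p) =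
      stdNormalQuantile α - √(n₁ : ℝ) * p.beta * sigmaXiSq P p / sigmaEpsXi P p := by
    rw [stdNormalQuantile_one_sub h0 h1]
    ring
  rw [eb] at b1 b2
  rw [ek1] at hup
  rw [ek2] at hlow
  have hcdf : ∀ t, |stdNormalCDF t| ≤ 1 := fun t => by
    rw [abs_of_nonneg (stdNormalCDF_nonneg t)]
    exact stdNormalCDF_le_one t
  -- The sign probabilities contribute `ε` and `2 * ε`, the atom of `β̂` at zero `3 * ε`, and each
  -- tail `e`.
  have p1 := abs_mul_sub_mul_le b1 hup
    (by rw [abs_of_nonneg measureReal_nonneg]; exact measureReal_le_one) (hcdf _)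
  have p2 := abs_mul_sub_mul_le b2 hlow
    (by rw [abs_of_nonneg measureReal_nonneg]; exact measureReal_le_one) (hcdf _)
  rw [psi]
  rw [abs_le] at hmain p1 p2 ⊢
  constructor <;> linarith [hmain.1, hmain.2, p1.1, p1.2, p2.1, p2.2]

/-- A perturbation size at which the studentisation error is negligible. -/
lemma exists_perturbation_size {s τ : ℝ} (hs : 0 < s) (hτ : 0 < τ) (z : ℝ) :
    ∃ h : ℝ, 0 < h ∧ √(9 * h) + (h + h ^ 2) / s < s ∧
      (|z| * (√(9 * h) + (h + h ^ 2) / s) + 3 * h) / s ≤ τ := by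
  -- Both expressions are continuous and vanish at `h = 0`, so any small positive `h` serves.
  have c1 : Continuous fun h : ℝ => √(9 * h) + (h + h ^ 2) / s := by fun_prop
  have c2 : Continuous fun h : ℝ => (|z| * (√(9 * h) + (h + h ^ 2) / s) + 3 * h) / s := by
    fun_prop
  have t1 := (c1.tendsto 0).eventually (eventually_lt_nhds (b := s) (by simpa using hs))
  have t2 := (c2.tendsto 0).eventually (eventually_le_nhds (b := τ) (by simpa using hτ))
  have t3 : ∀ᶠ h : ℝ in 𝓝[>] 0, 0 < h := self_mem_nhdsWithin
  obtain ⟨h, h3, h1, h2⟩ := (t3.and ((t1.and t2).filter_mono nhdsWithin_le_nhds)).exists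
  exact ⟨h, h3, h1, h2⟩

/-- Both tails of the residual statistic, uniformly over the family. -/
lemma eventually_residualStatistic_tails {est : Estimators U₁ U₂} {d : ℕ → ℕ → ℕ}
    {Fam : ∀ n₁ n₂ : ℕ, Set (ProbabilityMeasure (Obs (d n₁ n₂)))}
    {par : ∀ k : ℕ, ProbabilityMeasure (Obs k) → Params k}
    (hA : UnivariateXAssumption ν₁ ν₂ est d Fam par) {c C δ : ℝ} (hc : 0 < c) (hC : 0 < C)
    (hδ : 0 < δ)
    (hvar : ∀ n₁ n₂, ∀ P ∈ Fam n₁ n₂,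
      c < variance (epsXi (par _ P)) (P : Measure (Obs (d n₁ n₂))))
    (hmom : ∀ n₁ n₂, ∀ P ∈ Fam n₁ n₂,
      ∫⁻ o, ENNReal.ofReal (|epsXi (par _ P) o| ^ (2 + δ))
        ∂(P : Measure (Obs (d n₁ n₂))) ≤ ENNReal.ofReal C)
    (z : ℝ) {ε : ℝ} (hε : 0 < ε) :
    ∀ᶠ n : ℕ × ℕ in minAtTop, ∀ P ∈ Fam n.1 n.2,
      |(trainLaw ν₁ P n.1).real {w | z < residualStatistic est (d n.1 n.2) n.1 w} -
        stdNormalCDF (-(z - √(n.1 : ℝ) * ((par _ P).beta * sigmaXiSq P (par _ P)) /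
          sigmaEpsXi P (par _ P)))| ≤ 11 * ε ∧
      |(trainLaw ν₁ P n.1).real {w | z < -residualStatistic est (d n.1 n.2) n.1 w} -
        stdNormalCDF (-(z + √(n.1 : ℝ) * ((par _ P).beta * sigmaXiSq P (par _ P)) /
          sigmaEpsXi P (par _ P)))| ≤ 11 * ε := by
  obtain ⟨h, hh, hκ, hτ⟩ := exists_perturbation_size (Real.sqrt_pos.2 hc) hε z
  have hW1 := IsLittleOP.eventually_measureReal_le (W := fun n _ P w =>
    √(n : ℝ) * ‖est.theta _ n w - (par _ P).theta‖ *
      ‖(1 / (n : ℝ)) • ∑ i, resX (par _ P).eta (w.1 i) • (w.1 i).2.2‖)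
    hA.theta_cross hh hε
  have hW2 := IsLittleOP.eventually_measureReal_le (W := fun n _ P w =>
    √(n : ℝ) * ‖est.eta _ n w - (par _ P).eta‖ *
      ‖(1 / (n : ℝ)) • ∑ i, resY (par _ P).theta (w.1 i) • (w.1 i).2.2‖)
    hA.eta_cross hh hε
  have hW3 := IsLittleOP.eventually_measureReal_le (W := fun n _ P w =>
    √(n : ℝ) * ‖est.eta _ n w - (par _ P).eta‖ *
      ‖est.theta _ n w - (par _ P).theta‖ * gramOpNorm w.1)
    hA.eta_theta_gram hh hε
  have hW4 := IsLittleOP.eventually_measureReal_le (W := fun n _ P w =>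
    ‖est.theta _ n w - (par _ P).theta‖ ^ 2 *
      ((1 / (n : ℝ)) * ∑ i, resX (par _ P).eta (w.1 i) ^ 2 * ‖(w.1 i).2.2‖ ^ 2))
    hA.theta_square hh hε
  have hW5 := IsLittleOP.eventually_measureReal_le (W := fun n _ P w =>
    ‖est.eta _ n w - (par _ P).eta‖ ^ 2 *
      ((1 / (n : ℝ)) * ∑ i, resY (par _ P).theta (w.1 i) ^ 2 * ‖(w.1 i).2.2‖ ^ 2))
    hA.eta_square hh hε
  have hW6 := IsLittleOP.eventually_measureReal_le (W := fun n _ P w =>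
    ‖est.eta _ n w - (par _ P).eta‖ ^ 2 *
      ‖est.theta _ n w - (par _ P).theta‖ ^ 2 * ((1 / (n : ℝ)) * ∑ i, ‖(w.1 i).2.2‖ ^ 4))
    hA.eta_theta_square hh hε
  filter_upwards [hW1, hW2, hW3, hW4, hW5, hW6,
    tendsto_fst_minAtTop.eventually (eventually_forall_sample_limits (q := 2 + δ)
      (by linarith) hc hC hh hε),
    tendsto_fst_minAtTop.eventually (eventually_gt_atTop 0)]
    with n w1 w2 w3 w4 w5 w6 hlim hn P hP
  replace w1 := w1 P hP
  replace w2 := w2 P hP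
  replace w3 := w3 P hP
  replace w4 := w4 P hP
  replace w5 := w5 P hP
  replace w6 := w6 P hP
  set p := par _ P with hp
  have hfm := measurable_epsXi p
  obtain ⟨hint, hCf⟩ := integrable_and_integral_le_of_lintegral (by fun_prop)
    (fun o => Real.rpow_nonneg (abs_nonneg (epsXi p o)) (2 + δ)) hC.le (hmom _ _ P hP)
  have hv := hvar _ _ P hP
  obtain ⟨l1, l2, l3⟩ := hlim _ (P : Measure (Obs (d n.1 n.2))) (epsXi p) hfm hint hCf hv
  have hmean := integral_epsXi_eq (hA.second_moments _ _ P hP) (hA.linear_model _ _ P hP)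
    (hA.eta_projection _ _ P hP)
  rw [← hp] at hmean
  rw [hmean] at l1 l2 l3
  have hσ : √Var[epsXi p; (P : Measure (Obs (d n.1 n.2)))] = sigmaEpsXi P p := rfl
  have hσsq : Var[epsXi p; (P : Measure (Obs (d n.1 n.2)))] = sigmaEpsXi P p ^ 2 :=
    (Real.sq_sqrt (variance_nonneg _ _)).symm
  have hsσ : √c ≤ sigmaEpsXi P p := Real.sqrt_le_sqrt hv.le
  rw [hσ] at l1
  rw [hσsq] at l3
  set m := p.beta * sigmaXiSq P p with hm
  set σ := sigmaEpsXi P p with hσdef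
  have hfst : ∀ q : (Fin n.1 → Obs (d n.1 n.2)) → Prop,
      (trainLaw ν₁ P n.1).real {w | q w.1} =
        (Measure.pi fun _ : Fin n.1 => (P : Measure (Obs (d n.1 n.2)))).real {w | q w} :=
    fun q => measureReal_prod_fst q
  have hN : Measurable fun w : TrainSpace U₁ (d n.1 n.2) n.1 =>
      standardisedSum (fun i => epsXi p (w.1 i)) m σ := by
    unfold standardisedSum
    fun_prop
  have hclt : ∀ t, |(trainLaw ν₁ P n.1).real {w : TrainSpace U₁ (d n.1 n.2) n.1 |
      standardisedSum (fun i => epsXi p (w.1 i)) m σ ≤ t} - stdNormalCDF t| ≤ ε := by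
    intro t
    rw [hfst (fun w => standardisedSum (fun i => epsXi p (w i)) m σ ≤ t)]
    exact l1 t
  rw [← hfst (fun w => h ≤ |(1 / (n.1 : ℝ)) * ∑ i, epsXi p (w i) - m|)] at l2
  rw [← hfst (fun w => h ≤ |(1 / (n.1 : ℝ)) * ∑ i, (epsXi p (w i) - m) ^ 2 - σ ^ 2|)] at l3
  -- The exceptional set unites the six events from the rate conditions and the two from the laws of
  -- large numbers, each of probability at most `ε`. The comparison lemmas add at most `3 * ε`,
  -- giving `11 * ε`.
  obtain ⟨B, hB, hgood⟩ : ∃ B : Set (TrainSpace U₁ (d n.1 n.2) n.1),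
      (trainLaw ν₁ P n.1).real B ≤ 8 * ε ∧ ∀ w ∉ B,
    ((z - √(n.1 : ℝ) * m / σ + ε < standardisedSum (fun i => epsXi p (w.1 i)) m σ →
        z < residualStatistic est _ n.1 w) ∧
      (z < residualStatistic est _ n.1 w →
        z - √(n.1 : ℝ) * m / σ - ε < standardisedSum (fun i => epsXi p (w.1 i)) m σ)) ∧
    ((standardisedSum (fun i => epsXi p (w.1 i)) m σ < -(z + √(n.1 : ℝ) * m / σ) - ε →
        z < -residualStatistic est _ n.1 w) ∧
      (z < -residualStatistic est _ n.1 w →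
        standardisedSum (fun i => epsXi p (w.1 i)) m σ < -(z + √(n.1 : ℝ) * m / σ) + ε)) := by
    refine ⟨_, (measureReal_union_le _ _).trans (add_le_add ((measureReal_union_le _ _).trans
      (add_le_add ((measureReal_union_le _ _).trans (add_le_add ((measureReal_union_le _ _).trans
      (add_le_add ((measureReal_union_le _ _).trans (add_le_add ((measureReal_union_le _ _).trans
      (add_le_add ((measureReal_union_le _ _).trans (add_le_add w1 w2)) w3)) w4)) w5)) w6))
      l2)) l3) |>.trans (by linarith), fun w hw => ?_⟩
    simp only [Set.mem_union, Set.mem_ofPred_eq, not_or, not_lt, not_le] at hw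
    obtain ⟨⟨⟨⟨⟨⟨⟨k1, k2⟩, k3⟩, k4⟩, k5⟩, k6⟩, k7⟩, k8⟩ := hw
    exact residualStatistic_sandwich est hn p (Real.sqrt_pos.2 hc) hsσ hh hκ hτ w k1 k2 k3 k4 k5 k6
      k7.le k8.le
  constructor
  · refine (abs_measureReal_sub_le_of_upper hN hB hclt hε.le fun w hw => (hgood w hw).1).trans ?_
    linarith
  · refine (abs_measureReal_sub_le_of_lower hB hclt hε fun w hw => (hgood w hw).2).trans ?_
    linarith

end Power

end PCM

theorem mainTheorem8 {U₁ U₂ : Type*} [MeasurableSpace U₁] [MeasurableSpace U₂]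
    (ν₁ : Measure U₁) [IsProbabilityMeasure ν₁] (ν₂ : Measure U₂) [IsProbabilityMeasure ν₂]
    (est : PCM.Estimators U₁ U₂) (d : ℕ → ℕ → ℕ)
    (Fam : ∀ n₁ n₂ : ℕ, Set (ProbabilityMeasure (PCM.Obs (d n₁ n₂))))
    (par : ∀ k : ℕ, ProbabilityMeasure (PCM.Obs k) → PCM.Params k)
    (hA : PCM.UnivariateXAssumption ν₁ ν₂ est d Fam par)
    (c C δ : ℝ) (hc : 0 < c) (hC : 0 < C) (hδ : 0 < δ)
    (hvar : ∀ n₁ n₂, ∀ P ∈ Fam n₁ n₂,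
      c < variance (PCM.epsXi (par _ P)) (P : Measure (PCM.Obs (d n₁ n₂))))
    (hmom : ∀ n₁ n₂, ∀ P ∈ Fam n₁ n₂,
      ∫⁻ o, ENNReal.ofReal (|PCM.epsXi (par _ P) o| ^ (2 + δ))
        ∂(P : Measure (PCM.Obs (d n₁ n₂))) ≤ ENNReal.ofReal C)
    (α : ℝ) (hα0 : 0 < α) (hα1 : α < 1) :
    Tendsto (fun n : ℕ × ℕ => ⨆ P ∈ Fam n.1 n.2, ENNReal.ofReal
      |(PCM.sampleLaw ν₁ ν₂ P n.1 n.2).real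
          {ω | PCM.stdNormalQuantile (1 - α) < PCM.pcmStatistic est (d n.1 n.2) n.1 n.2 ω} -
        PCM.psi P (par _ P) α n.1 n.2|) PCM.minAtTop (𝓝 0) ∧
    (∀ n₁ n₂, ∀ P ∈ Fam n₁ n₂,
      ∫ o, PCM.resX (par _ P).eta o ∂(P : Measure (PCM.Obs (d n₁ n₂))) = 0 →
      PCM.sigmaXiSq P (par _ P) =
        variance (PCM.resX (par _ P).eta) (P : Measure (PCM.Obs (d n₁ n₂)))) ∧
    (α < 1 / 2 → ∀ n₁ n₂, 0 < n₁ → 0 < n₂ → ∀ P ∈ Fam n₁ n₂,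
      α ≤ PCM.psi P (par _ P) α n₁ n₂ ∧
        (PCM.psi P (par _ P) α n₁ n₂ = α ↔ (par _ P).beta = 0)) := by
  refine ⟨?_, fun n₁ n₂ P hP h0 => ?_, fun hα n₁ n₂ hn₁ hn₂ P hP => ?_⟩
  · rw [PCM.tendsto_biSup_zero_iff]
    intro η hη
    -- `28 = 6 + 2 * 11`: the total error is `6 * ε` plus twice the tail error `11 * ε`.
    have hε : 0 < η / 28 := by positivity
    have hbeta := PCM.tendsto_biSup_zero_iff.1 hA.beta_normal (η / 28) hε
    filter_upwards [hbeta, PCM.eventually_residualStatistic_tails hA hc hC hδ hvar hmom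
      (PCM.stdNormalQuantile (1 - α)) hε,
      PCM.tendsto_snd_minAtTop.eventually (eventually_gt_atTop 0)] with n hb htails hn P hP
    have hb' : ∀ t : ℝ, |(PCM.sampleLaw ν₁ ν₂ P n.1 n.2).real
          {ω | √(n.2 : ℝ) * (par _ P).sigmaBeta⁻¹ *
            (est.beta (d n.1 n.2) n.2 ω.2 - (par _ P).beta) ≤ t} - PCM.stdNormalCDF t| ≤
          η / 28 := fun t =>
      (ENNReal.ofReal_le_ofReal_iff hε.le).1 ((le_iSup (fun t : ℝ => ENNReal.ofReal
        |(PCM.sampleLaw ν₁ ν₂ P n.1 n.2).real {ω | √(n.2 : ℝ) * (par _ P).sigmaBeta⁻¹ *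
          (est.beta (d n.1 n.2) n.2 ω.2 - (par _ P).beta) ≤ t} - PCM.stdNormalCDF t|) t).trans
            (hb P hP))
    obtain ⟨t1, t2⟩ := htails P hP
    refine ENNReal.ofReal_le_ofReal ((PCM.abs_measureReal_pcmStatistic_sub_psi_le est hα0 hα1 hε hn
      (hA.sigmaBeta_pos _ _ P hP) hb' t1 t2).trans ?_)
    linarith
  · rw [variance_of_integral_eq_zero (PCM.measurable_resX _).aemeasurable h0]
    rfl
  · have hv := hc.trans (hvar n₁ n₂ P hP)
    by_cases hβ : (par _ P).beta = 0
    · have h := PCM.psi_eq_of_beta_eq_zero (P := P) hα0 hα1 hβ n₁ n₂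
      exact ⟨h.ge, fun _ => hβ, fun _ => h⟩
    · have h := PCM.lt_psi_of_beta_ne_zero hα0 hα hβ (hA.sigmaBeta_pos _ _ P hP)
        (PCM.sigmaXiSq_pos (hA.second_moments _ _ P hP) hv) (Real.sqrt_pos.2 hv) hn₁ hn₂
      exact ⟨h.le, fun h' => absurd h' h.ne', fun h' => absurd h' hβ⟩
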